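/- Let $\Omega\subset\mathbb R^2$ be a bounded open set with $\Omega=\operatorname{int}(\overline\Omega)$ (for instance a bounded Lipschitz domain with polygonal boundary). Let $\mathcal T$ be a regular triangulation of $\Omega$: a finite set of nondegenerate closed triangles with $\bigcup\mathcal T=\overline\Omega$ such that any two distinct triangles are disjoint or share exactly a vertex or exactly a side. Let $\mathcal N(T)$ be the set of vertices of $T\in\mathcal T$ and $h_T=\operatorname{diam}(T)$, and let $h_{\mathcal T}|_T=h_T$. A vertex (node) is interior if it lies in $\Omega$ and a boundary node if it lies on $\partial\Omega$; a side is a boundary side if it is contained in $\partial\Omega$ and an interior side otherwise. For a node $z$ let $\mathcal T(z)=\{T\in\mathcal T: z\in\mathcal N(T)\}$ and $\omega_z=\bigcup\mathcal T(z)$; for $T\in\mathcal T$ let $\omega_T=\bigcup_{z\in\mathcal N(T)}\omega_z$. Let $\omega_0>0$ be a lower bound of all interior angles of the triangles in $\mathcal T$, and let $M_{\rm int}$ (resp. $M_{\rm bd}$) be the maximum of $|\mathcal T(z)|$ over all interior (resp. boundary) nodes $z$. Let $P_1(\mathcal T)$ be the space of all $v\in L^2(\Omega)$ such that $v|_T$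 is a polynomial of degree at most one for every $T\in\mathcal T$, let $\nabla_{NC}$ be the piecewise gradient, and let $S^1_0(\mathcal T)=P_1(\mathcal T)\cap H^1_0(\Omega)$. Let $CR^1_0(\mathcal T)$ be the space of all $v\in P_1(\mathcal T)$ that are continuous at the midpoints of interior sides and vanish at the midpoints of boundary sides. For $v\in CR^1_0(\mathcal T)$ let $J_1v$ be the continuous piecewise affine function with $$J_1v(z)=\frac1{|\mathcal T(z)|}\sum_{T\in\mathcal T(z)}(v|_T)(z)\ \text{ at interior nodes } z,\qquad J_1v(z)=0\ \text{ at boundary nodes } z.$$ Set $$c_{\rm apx}(J_1)^2=\frac{(\sqrt3/2)\cot(\omega_0)}{\min\{1-\cos(2\pi/M_{\rm int}),\,1-\cos(\pi/M_{\rm bd})\}},\qquad c_{\rm apx}(J_1)\ge 0,$$ where the term with $M_{\rm int}$ is omitted if there are no interior nodes. Then every $v\in CR^1_0(\mathcal T)$ satisfies $J_1v\in S^1_0(\mathcal T)$, $$\|h_{\mathcal T}^{-1}(v-J_1v)\|_{L^2(\Omega)}\le c_{\rm apx}(J_1)\,\|\nabla_{NC}v\|_{L^2(\Omega)},$$ and,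 for every $T\in\mathcal T$, $$\|h_T^{-1}(v-J_1v)\|_{L^2(T)}\le c_{\rm apx}(J_1)\,\|\nabla_{NC}v\|_{L^2(\omega_T)}.$$ -/

import Mathlib

open MeasureTheory Filter Topology
open scoped ContDiff ENNReal

noncomputable section

namespace CrouzeixRaviart

/-- The Euclidean plane. -/
abbrev Plane := EuclideanSpace ℝ (Fin 2)

/-- The closed triangle spanned by a finite set of vertices. -/
def hull (T : Finset Plane) : Set Plane := convexHull ℝ (T : Set Plane)

/-- A regular triangulation of `Ω` into nondegenerate closed triangles. A triangle is given by the
set of its three vertices. Two triangles meet in the convex hull of their common vertices, so two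
distinct ones are disjoint or share exactly a vertex or exactly a side. -/
structure RegularTriangulation (Ω : Set Plane) where
  /-- the triangles, as vertex sets -/
  cells : Finset (Finset Plane)
  card_eq : ∀ T ∈ cells, T.card = 3
  affineIndependent : ∀ T ∈ cells, AffineIndependent ℝ ((↑) : T → Plane)
  inter_eq : ∀ T ∈ cells, ∀ T' ∈ cells,
    hull T ∩ hull T' = convexHull ℝ ((T : Set Plane) ∩ (T' : Set Plane))
  closure_eq : closure Ω = ⋃ T ∈ cells, hull T

namespace RegularTriangulation

variable {Ω : Set Plane} (𝒯 : RegularTriangulation Ω)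

open Classical in
/-- The nodes. -/
def nodes : Finset Plane := 𝒯.cells.biUnion id

open Classical in
/-- The interior nodes. -/
def interiorNodes : Finset Plane := 𝒯.nodes.filter (fun z => z ∈ Ω)

open Classical in
/-- The boundary nodes. -/
def boundaryNodes : Finset Plane := 𝒯.nodes.filter (fun z => z ∈ frontier Ω)

open Classical in
/-- The triangles with vertex `z`. -/
def cellsAt (z : Plane) : Finset (Finset Plane) := 𝒯.cells.filter (fun T => z ∈ T)

/-- The nodal patch of `z`: the union of the triangles with vertex `z`. -/
def nodePatch (z : Plane) : Set Plane := ⋃ T ∈ 𝒯.cellsAt z, hull T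

/-- The patch of a triangle: the union of the nodal patches of its vertices. -/
def cellPatch (T : Finset Plane) : Set Plane := ⋃ z ∈ T, 𝒯.nodePatch z

/-- The maximal number of triangles at an interior node (`0` if there is no interior node). -/
def Mint : ℕ := 𝒯.interiorNodes.sup (fun z => (𝒯.cellsAt z).card)

/-- The maximal number of triangles at a boundary node. -/
def Mbd : ℕ := 𝒯.boundaryNodes.sup (fun z => (𝒯.cellsAt z).card)

/-- `ω₀` is a positive lower bound of all interior angles of all triangles. -/
def IsMinAngleBound (ω₀ : ℝ) : Prop :=
  0 < ω₀ ∧ ∀ T ∈ 𝒯.cells, ∀ x ∈ T, ∀ z ∈ T, ∀ y ∈ T, x ≠ z → y ≠ z → x ≠ y →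
    ω₀ ≤ EuclideanGeometry.angle x z y

/-- Piecewise affine functions: on every triangle the function agrees almost everywhere with a
polynomial of degree at most one. -/
def MemP1 (v : Plane → ℝ) : Prop :=
  ∀ T ∈ 𝒯.cells, ∃ p : Plane →ᵃ[ℝ] ℝ, v =ᵐ[volume.restrict (hull T)] p

open Classical in
/-- The polynomial `v|_T` of a piecewise affine function `v` on the triangle `T`. -/
def piece (v : Plane → ℝ) (T : Finset Plane) : Plane →ᵃ[ℝ] ℝ :=
  if h : ∃ p : Plane →ᵃ[ℝ] ℝ, v =ᵐ[volume.restrict (hull T)] p then h.choose else 0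

/-- The Crouzeix–Raviart space with zero boundary values. A side is given by its two end points
`x ≠ y` in a common triangle. It is a boundary side if it is contained in the boundary of `Ω` and
an interior side otherwise. The polynomials of `v` on the triangles that share an interior side
coincide at its midpoint, and `v` vanishes at the midpoint of every boundary side. -/
def MemCR10 (v : Plane → ℝ) : Prop :=
  𝒯.MemP1 v ∧
  (∀ x y : Plane, x ≠ y → ¬ segment ℝ x y ⊆ frontier Ω →
    ∀ T ∈ 𝒯.cells, ∀ T' ∈ 𝒯.cells, x ∈ T → y ∈ T → x ∈ T' → y ∈ T' →
      piece v T (midpoint ℝ x y) = piece v T' (midpoint ℝ x y)) ∧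
  (∀ x y : Plane, x ≠ y → segment ℝ x y ⊆ frontier Ω →
    ∀ T ∈ 𝒯.cells, x ∈ T → y ∈ T → piece v T (midpoint ℝ x y) = 0)

end RegularTriangulation

/-- `v ∈ H¹₀(Ω)`: the function `v` is the limit in `H¹(Ω)` of smooth functions with compact support
in `Ω` (the limit `g` of their gradients is the weak gradient of `v`). -/
def MemH10 (Ω : Set Plane) (v : Plane → ℝ) : Prop :=
  MemLp v 2 (volume.restrict Ω) ∧
  ∃ g : Plane → Plane, MemLp g 2 (volume.restrict Ω) ∧
  ∃ φ : ℕ → Plane → ℝ,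
    (∀ n, ContDiff ℝ ∞ (φ n) ∧ HasCompactSupport (φ n) ∧ tsupport (φ n) ⊆ Ω) ∧
    Tendsto (fun n => eLpNorm (fun x => φ n x - v x) 2 (volume.restrict Ω)) atTop (𝓝 0) ∧
    Tendsto (fun n => eLpNorm (fun x => gradient (φ n) x - g x) 2 (volume.restrict Ω))
      atTop (𝓝 0)

namespace RegularTriangulation

variable {Ω : Set Plane} (𝒯 : RegularTriangulation Ω)

/-- The conforming space: piecewise affine functions in `H¹₀(Ω)`. -/
def MemS10 (v : Plane → ℝ) : Prop := 𝒯.MemP1 v ∧ MemH10 Ω v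

open Classical in
/-- The nodal values of `J₁ v`: the average of the values `v|_T(z)` at an interior node `z`,
and zero otherwise. -/
def nodalAverage (v : Plane → ℝ) (z : Plane) : ℝ :=
  if z ∈ 𝒯.interiorNodes then
    ((𝒯.cellsAt z).card : ℝ)⁻¹ * ∑ T ∈ 𝒯.cellsAt z, piece v T z
  else 0

open Classical in
/-- The affine function with the values `a z` at the vertices `z` of the triangle `T`. -/
def affineInterp (T : Finset Plane) (a : Plane → ℝ) : Plane →ᵃ[ℝ] ℝ :=
  if h : ∃ p : Plane →ᵃ[ℝ] ℝ, ∀ z ∈ T, p z = a z then h.choose else 0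

open Classical in
/-- The averaging enrichment operator `J₁`: the continuous piecewise affine function on the closure
of `Ω` with the averaged nodal values (by regularity the value at `x` does not depend on the
triangle chosen among those that contain `x`), extended by zero. -/
def J1 (v : Plane → ℝ) (x : Plane) : ℝ :=
  if h : ∃ T ∈ 𝒯.cells, x ∈ hull T then affineInterp h.choose (𝒯.nodalAverage v) x else 0

/-- The diameter of a triangle. -/
def diamCell (T : Finset Plane) : ℝ := Metric.diam (hull T)

/-- The piecewise constant mesh size, equal to `diamCell T` in the interior of `T`. -/
def meshSize (x : Plane) : ℝ :=
  ∑ T ∈ 𝒯.cells, (interior (hull T)).indicator (fun _ => diamCell T) x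

/-- The piecewise gradient, equal to the gradient of `v|_T` in the interior of `T`. -/
def gradNC (v : Plane → ℝ) (x : Plane) : Plane :=
  ∑ T ∈ 𝒯.cells, (interior (hull T)).indicator (fun y => gradient (piece v T) y) x

/-- The `L²` norm of the piecewise gradient on `s`. -/
def energyNorm (v : Plane → ℝ) (s : Set Plane) : ℝ≥0∞ :=
  eLpNorm (𝒯.gradNC v) 2 (volume.restrict s)

open Classical in
/-- `min {1 - cos (2π / Mint), 1 - cos (π / Mbd)}`, where the first term is dropped if there is no
interior node. -/
def eigenvalueFactor : ℝ :=
  if 𝒯.interiorNodes.Nonempty then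
    min (1 - Real.cos (2 * Real.pi / 𝒯.Mint)) (1 - Real.cos (Real.pi / 𝒯.Mbd))
  else 1 - Real.cos (Real.pi / 𝒯.Mbd)

/-- The constant `c_apx(J₁)`. -/
def capxJ1 (ω₀ : ℝ) : ℝ :=
  Real.sqrt (Real.sqrt 3 / 2 * Real.cot ω₀ / 𝒯.eigenvalueFactor)

end RegularTriangulation

end CrouzeixRaviart

end

/-! At a node `z` put `x_T = v|_T(z) - J₁v(z)`. If `T` and `T'` share the side from `z` to `b`,
their polynomials agree at its midpoint, so `x_T' - x_T` is half the difference of their increments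
along `b - z`, and its square is at most half the sum of the squared increments. If the side lies on
the boundary, then `x_T` is minus half the increment.

Around an interior node the triangles form one cycle and the `x_T` have mean zero, so the discrete
Wirtinger inequality bounds `∑ x_T²` by the squared jumps, with the constant `2(1 - cos(2π/N))` for
a cycle of length `N`. Around a boundary node the triangles form paths. A path is run there and
back, with `x` on the way out and `-x` on the way back. This is a cycle of twice the length with
mean zero, whose jumps `2x_T` at the turning points are controlled by the boundary condition. Hence
`π/N` in place of `2π/N`. Both cases are combined in `node_estimate`.

The rest is summation. Every side of `T` counts twice, and the squared sides of `T` add up to `4|T|`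
times the sum of the cotangents of the angles, at most `12|T| cot ω₀`. This gives `24 cot ω₀
|T||∇v|²` (`sum_sq_linear_le`). Convexity of the square bounds the `L²` norm of an affine function
by `|T|/3` times its squared nodal values, and Weitzenböck's inequality gives `|T| ≤ (√3/4) h_T²`,
whence the factor `√3/12` in `lintegral_cell_le`.

The topological input is that a family of triangles at `z` in which each has both neighbours covers
a neighbourhood of `z` (`IsClosedFan.exists_bary_nonneg`, by connectedness of the punctured plane).
So such a family cannot exist at a boundary node and is the whole star at an interior one.

For `J₁v ∈ H¹₀(Ω)`: `J₁v` is Lipschitz, piecewise affine and zero off `Ω`. Soft thresholding makes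
its support compact in `Ω`, and mollification then yields test functions whose gradients are
eventually exact at almost every point (`memH10_of_lipschitz`). -/

namespace CrouzeixRaviart

/-! ### Discrete Wirtinger inequality by Fourier analysis on a finite cycle. -/

section Wirtinger

open Complex in
lemma sum_pow_mul_conj_pow {N : ℕ} {ζ : ℂ} (hζ : IsPrimitiveRoot ζ N) {j l : ℕ}
    (hj : j < N) (hl : l < N) :
    ∑ k ∈ Finset.range N, (ζ ^ j) ^ k * (starRingEnd ℂ) ((ζ ^ l) ^ k)
      = if j = l then (N : ℂ) else 0 := by
  have hN : N ≠ 0 := by omega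
  have hn : ‖ζ‖ = 1 := hζ.norm'_eq_one hN
  have hζ0 : ζ ≠ 0 := hζ.ne_zero hN
  have hc : (starRingEnd ℂ) ζ = ζ⁻¹ := by
    rw [Complex.inv_def, Complex.normSq_eq_norm_sq, hn]; simp
  have key : ∀ k, (ζ ^ j) ^ k * (starRingEnd ℂ) ((ζ ^ l) ^ k) = (ζ ^ j * (ζ ^ l)⁻¹) ^ k := by
    intro k
    rw [map_pow, map_pow, hc, mul_pow, inv_pow]
  simp_rw [key]
  split_ifs with h
  · subst h
    simp [hζ0]
  · have hne : ζ ^ j * (ζ ^ l)⁻¹ ≠ 1 := by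
      intro h1
      have : ζ ^ j = ζ ^ l := by
        field_simp at h1
        exact h1
      exact h (hζ.pow_inj hj hl this)
    have h2 := mul_neg_geom_sum (ζ ^ j * (ζ ^ l)⁻¹) N
    have h3 : (ζ ^ j * (ζ ^ l)⁻¹) ^ N = 1 := by
      rw [mul_pow, inv_pow, ← pow_mul, ← pow_mul, mul_comm j, mul_comm l, pow_mul, pow_mul,
        hζ.pow_eq_one]
      simp
    rw [h3, sub_self] at h2
    rcases mul_eq_zero.1 h2 with h4 | h4
    · exact absurd (sub_eq_zero.1 h4).symm hne
    · exact h4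

/-- Parseval's identity for a finite sequence of real numbers. -/
lemma sum_normSq_dft {N : ℕ} {ζ : ℂ} (hζ : IsPrimitiveRoot ζ N) (y : ℕ → ℝ) :
    ∑ k ∈ Finset.range N, Complex.normSq (∑ j ∈ Finset.range N, (y j : ℂ) * (ζ ^ j) ^ k)
      = N * ∑ j ∈ Finset.range N, y j ^ 2 := by
  have : ((∑ k ∈ Finset.range N,
      Complex.normSq (∑ j ∈ Finset.range N, (y j : ℂ) * (ζ ^ j) ^ k) : ℝ) : ℂ)
      = ((N * ∑ j ∈ Finset.range N, y j ^ 2 : ℝ) : ℂ) := by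
    push_cast
    calc ∑ k ∈ Finset.range N,
          ((Complex.normSq (∑ j ∈ Finset.range N, (y j : ℂ) * (ζ ^ j) ^ k) : ℝ) : ℂ)
        = ∑ k ∈ Finset.range N, ∑ j ∈ Finset.range N, ∑ l ∈ Finset.range N,
          (y j : ℂ) * y l * ((ζ ^ j) ^ k * (starRingEnd ℂ) ((ζ ^ l) ^ k)) := by
          refine Finset.sum_congr rfl fun k _ => ?_
          rw [← Complex.mul_conj, map_sum, Finset.sum_mul_sum]
          refine Finset.sum_congr rfl fun j _ => Finset.sum_congr rfl fun l _ => ?_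
          rw [map_mul, Complex.conj_ofReal]
          ring
      _ = ∑ j ∈ Finset.range N, ∑ l ∈ Finset.range N, (y j : ℂ) * y l *
          (if j = l then (N : ℂ) else 0) := by
          rw [Finset.sum_comm]
          refine Finset.sum_congr rfl fun j hj => ?_
          rw [Finset.sum_comm]
          refine Finset.sum_congr rfl fun l hl => ?_
          rw [← Finset.mul_sum,
            sum_pow_mul_conj_pow hζ (Finset.mem_range.1 hj) (Finset.mem_range.1 hl)]
      _ = _ := by
          rw [Finset.mul_sum]
          refine Finset.sum_congr rfl fun j hj => ?_
          simp only [mul_ite, mul_zero, Finset.sum_ite_eq, hj, if_true]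
          ring
  exact_mod_cast this

lemma cos_le_cos_of_mem_Icc {a θ : ℝ} (h0 : 0 ≤ a) (h1 : a ≤ θ) (h2 : θ ≤ 2 * Real.pi - a) :
    Real.cos θ ≤ Real.cos a := by
  rcases le_total θ Real.pi with h | h
  · exact Real.cos_le_cos_of_nonneg_of_le_pi h0 h h1
  · rw [← Real.cos_two_pi_sub θ]
    exact Real.cos_le_cos_of_nonneg_of_le_pi h0 (by linarith) (by linarith)

/-- The discrete Wirtinger inequality for a periodic sequence with vanishing mean. -/
lemma discrete_wirtinger {N L : ℕ} (hNL : N ≤ L) (hN : 0 < N) (y : ℕ → ℝ) (hper : y N = y 0)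
    (hsum : ∑ j ∈ Finset.range N, y j = 0) :
    2 * (1 - Real.cos (2 * Real.pi / L)) * ∑ j ∈ Finset.range N, y j ^ 2
      ≤ ∑ j ∈ Finset.range N, (y (j + 1) - y j) ^ 2 := by
  set ζ : ℂ := Complex.exp (2 * Real.pi * Complex.I / N) with hζdef
  have hζ : IsPrimitiveRoot ζ N := Complex.isPrimitiveRoot_exp N hN.ne'
  have hn : ‖ζ‖ = 1 := hζ.norm'_eq_one hN.ne'
  set Y : ℕ → ℂ := fun k => ∑ j ∈ Finset.range N, (y j : ℂ) * (ζ ^ j) ^ k with hY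
  set D : ℕ → ℂ := fun k =>
    ∑ j ∈ Finset.range N, ((y (j + 1) - y j : ℝ) : ℂ) * (ζ ^ j) ^ k with hD
  -- By periodicity a shift of the sequence multiplies its Fourier coefficients by a root of unity,
  -- so differencing becomes multiplication by `1 - ζ ^ k`, up to a unimodular factor.
  have hYD : ∀ k : ℕ, ζ ^ k * D k = (1 - ζ ^ k) * Y k := by
    intro k
    have e1 : ζ ^ k * D k = ∑ j ∈ Finset.range N, (y (j + 1) : ℂ) * (ζ ^ (j + 1)) ^ k
        - ζ ^ k * Y k := by
      simp only [hD, hY, Finset.mul_sum, ← Finset.sum_sub_distrib]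
      refine Finset.sum_congr rfl fun j _ => ?_
      push_cast
      rw [pow_succ, mul_pow]
      ring
    have e2 : ∑ j ∈ Finset.range N, (y (j + 1) : ℂ) * (ζ ^ (j + 1)) ^ k = Y k := by
      have h1 := Finset.sum_range_succ' (fun j => (y j : ℂ) * (ζ ^ j) ^ k) N
      have h2 := Finset.sum_range_succ (fun j => (y j : ℂ) * (ζ ^ j) ^ k) N
      simp only [hζ.pow_eq_one, hper, pow_zero] at h1 h2
      rw [h2] at h1
      exact (add_right_cancel h1).symm
    rw [e1, e2]; ring
  have hDn : ∀ k : ℕ, Complex.normSq (D k) = Complex.normSq (1 - ζ ^ k) * Complex.normSq (Y k) := by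
    intro k
    have := congrArg Complex.normSq (hYD k)
    rw [map_mul, map_mul] at this
    rw [← this, Complex.normSq_eq_norm_sq (ζ ^ k), norm_pow, hn]
    simp
  have hfac : ∀ k : ℕ, Complex.normSq (1 - ζ ^ k) = 2 * (1 - Real.cos (2 * Real.pi * k / N)) := by
    intro k
    have : ζ ^ k = Complex.exp (((2 * Real.pi * k / N : ℝ) : ℂ) * Complex.I) := by
      rw [hζdef, ← Complex.exp_nat_mul]
      congr 1
      push_cast
      ring
    rw [this, Complex.normSq_apply]
    simp only [Complex.sub_re, Complex.one_re, Complex.sub_im, Complex.one_im,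
      Complex.exp_ofReal_mul_I_re, Complex.exp_ofReal_mul_I_im]
    nlinarith [Real.sin_sq_add_cos_sq (2 * Real.pi * k / N)]
  have hNR : (0 : ℝ) < N := by exact_mod_cast hN
  have hLR : (N : ℝ) ≤ L := by exact_mod_cast hNL
  -- The frequency `k = 0` drops out because the mean vanishes. For `1 ≤ k ≤ N - 1` the angle
  -- `2πk/N` keeps the distance `2π/N ≥ 2π/L` from `0` and `2π`.
  have hterm : ∀ k ∈ Finset.range N,
      2 * (1 - Real.cos (2 * Real.pi / L)) * Complex.normSq (Y k) ≤ Complex.normSq (D k) := by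
    intro k hk
    rcases Nat.eq_zero_or_pos k with rfl | hkp
    · have : Y 0 = 0 := by
        simp only [hY, pow_zero, mul_one]
        exact_mod_cast hsum
      rw [hDn, this]
      simp
    · rw [hDn, hfac]
      refine mul_le_mul_of_nonneg_right ?_ (Complex.normSq_nonneg _)
      have hk1 : (1 : ℝ) ≤ k := by exact_mod_cast hkp
      have hk2 : (k : ℝ) + 1 ≤ N := by exact_mod_cast Finset.mem_range.1 hk
      have hπ := Real.pi_pos
      have h1 : 2 * Real.pi / L ≤ 2 * Real.pi / N :=
        div_le_div_of_nonneg_left (by positivity) hNR hLR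
      have h2 : 2 * Real.pi / N ≤ 2 * Real.pi * k / N := by
        exact div_le_div_of_nonneg_right (by nlinarith) hNR.le
      have h3 : 2 * Real.pi * k / N ≤ 2 * Real.pi - 2 * Real.pi / N := by
        rw [le_sub_iff_add_le, ← add_div, div_le_iff₀ hNR]
        nlinarith
      have := cos_le_cos_of_mem_Icc (a := 2 * Real.pi / L) (θ := 2 * Real.pi * k / N)
        (by positivity) (by linarith) (by linarith)
      linarith
  have hs := Finset.sum_le_sum hterm
  rw [← Finset.mul_sum, sum_normSq_dft hζ y, sum_normSq_dft hζ (fun j => y (j + 1) - y j)] at hs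
  refine le_of_mul_le_mul_left ?_ hNR
  calc _ = 2 * (1 - Real.cos (2 * Real.pi / L)) * (N * ∑ j ∈ Finset.range N, y j ^ 2) := by ring
    _ ≤ _ := hs

lemma sum_range_mul_of_periodic {N : ℕ} {F : ℕ → ℝ} (hF : ∀ k, F (k + N) = F k) (m : ℕ) :
    ∑ k ∈ Finset.range (m * N), F k = m * ∑ k ∈ Finset.range N, F k := by
  have hF' : ∀ m k, F (m * N + k) = F k := by
    intro m
    induction m with
    | zero => simp
    | succ m ih =>
      intro k
      rw [show (m + 1) * N + k = (m * N + k) + N by ring, hF, ih]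
  induction m with
  | zero => simp
  | succ m ih =>
    rw [Nat.succ_mul, Finset.sum_range_add, ih, Finset.sum_congr rfl fun k _ => hF' m k]
    push_cast
    ring

lemma perm_iterate_orderOf {X : Type*} (σ : Equiv.Perm X) (i : X) : σ^[orderOf σ] i = i := by
  rw [Equiv.Perm.iterate_eq_pow, pow_orderOf_eq_one, Equiv.Perm.one_apply]

lemma sum_iterate {X : Type*} [Fintype X] (σ : Equiv.Perm X) (F : X → ℝ) (P : ℕ) :
    ∑ i, ∑ k ∈ Finset.range P, F (σ^[k] i) = P * ∑ i, F i := by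
  rw [Finset.sum_comm]
  have : ∀ k, ∑ i, F (σ^[k] i) = ∑ i, F i := by
    intro k
    simp only [Equiv.Perm.iterate_eq_pow]
    exact Equiv.sum_comp (σ ^ k) F
  simp [this]

/-- The discrete Wirtinger inequality for a permutation and a function that has vanishing
sum over the orbits. -/
lemma perm_wirtinger {X : Type*} [Fintype X] (σ : Equiv.Perm X) (x : X → ℝ) (L : ℕ)
    (hL : ∀ i, Function.minimalPeriod σ i ≤ L)
    (hsum : ∀ i, ∑ k ∈ Finset.range (orderOf σ), x (σ^[k] i) = 0) :
    2 * (1 - Real.cos (2 * Real.pi / L)) * ∑ i, x i ^ 2 ≤ ∑ i, (x (σ i) - x i) ^ 2 := by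
  set P := orderOf σ with hP
  have hP0 : 0 < P := orderOf_pos σ
  set c := 2 * (1 - Real.cos (2 * Real.pi / L)) with hc
  -- The walk of length `orderOf σ` from `i` runs a whole number `m` of times round the orbit of
  -- `i`, so the inequality on the orbit is multiplied by `m`.
  have key : ∀ i, c * ∑ k ∈ Finset.range P, x (σ^[k] i) ^ 2
      ≤ ∑ k ∈ Finset.range P, (x (σ (σ^[k] i)) - x (σ^[k] i)) ^ 2 := by
    intro i
    have hdvd : Function.minimalPeriod σ i ∣ P :=
      Function.IsPeriodicPt.minimalPeriod_dvd (perm_iterate_orderOf σ i)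
    obtain ⟨m, hm⟩ := hdvd
    set N := Function.minimalPeriod σ i with hN
    have hm0 : 0 < m := by
      rcases Nat.eq_zero_or_pos m with rfl | h
      · omega
      · exact h
    have hN0 : 0 < N := by
      rcases Nat.eq_zero_or_pos N with h | h
      · rw [h] at hm; omega
      · exact h
    have hper : ∀ k, σ^[k + N] i = σ^[k] i := fun k => Function.iterate_add_minimalPeriod_eq
    have hmR : (0 : ℝ) < m := by exact_mod_cast hm0
    have hs := hsum i
    rw [hm, mul_comm N m] at hs ⊢
    rw [sum_range_mul_of_periodic (F := fun k => x (σ^[k] i)) (fun k => by rw [hper])] at hs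
    rw [sum_range_mul_of_periodic (F := fun k => x (σ^[k] i) ^ 2) (fun k => by rw [hper]),
      sum_range_mul_of_periodic (F := fun k => (x (σ (σ^[k] i)) - x (σ^[k] i)) ^ 2)
        (fun k => by rw [hper])]
    have hs' := (mul_eq_zero.1 hs).resolve_left hmR.ne'
    have hw := discrete_wirtinger (hL i) hN0 (fun k => x (σ^[k] i))
      (by simp) hs'
    simp only [Function.iterate_succ_apply'] at hw
    calc _ = m * (c * ∑ k ∈ Finset.range N, x (σ^[k] i) ^ 2) := by ring
      _ ≤ _ := by gcongr
  -- Summing over all starting points counts each point `P` times, which avoids a choice of orbit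
  -- representatives.
  have hs := Finset.sum_le_sum fun i (_ : i ∈ Finset.univ) => key i
  rw [← Finset.mul_sum, sum_iterate σ (fun i => x i ^ 2),
    sum_iterate σ (fun i => (x (σ i) - x i) ^ 2)] at hs
  have hPR : (0 : ℝ) < P := by exact_mod_cast hP0
  refine le_of_mul_le_mul_left ?_ hPR
  calc _ = c * (P * ∑ i, x i ^ 2) := by ring
    _ ≤ _ := hs

end Wirtinger

/-! ### Combinatorics of the triangles at a node, with first and last neighbouring vertices `f` and
`l`. -/

section Fan

lemma minimalPeriod_le_card {X : Type*} [Fintype X] (σ : X → X) (i : X) :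
    Function.minimalPeriod σ i ≤ Fintype.card X := by
  have h : Function.Injective fun k : Fin (Function.minimalPeriod σ i) => σ^[k] i := by
    intro a b hab
    exact Fin.ext (Function.iterate_injOn_Iio_minimalPeriod a.2 b.2 hab)
  simpa using Fintype.card_le_of_injective _ h

lemma sum_orbit_apply {X : Type*} (σ : Equiv.Perm X) (y : X → ℝ) (p : X) :
    ∑ k ∈ Finset.range (orderOf σ), y (σ^[k] (σ p))
      = ∑ k ∈ Finset.range (orderOf σ), y (σ^[k] p) := by
  have h1 := Finset.sum_range_succ (fun k => y (σ^[k] p)) (orderOf σ)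
  have h2 := Finset.sum_range_succ' (fun k => y (σ^[k] p)) (orderOf σ)
  rw [h2] at h1
  simp only [perm_iterate_orderOf, Function.iterate_zero, id, Function.iterate_succ_apply] at h1
  exact add_right_cancel h1

lemma sum_orbit_iterate {X : Type*} (σ : Equiv.Perm X) (y : X → ℝ) (p : X) (m : ℕ) :
    ∑ k ∈ Finset.range (orderOf σ), y (σ^[k] (σ^[m] p))
      = ∑ k ∈ Finset.range (orderOf σ), y (σ^[k] p) := by
  induction m with
  | zero => simp
  | succ m ih => rw [Function.iterate_succ_apply', sum_orbit_apply, ih]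

/-- A permutation of finite order has its inverse among its powers, so forward orbits also contain
predecessors. -/
lemma exists_iterate_succ_eq {X : Type*} [Finite X] (σ : Equiv.Perm X) (p : X) (k : ℕ) :
    ∃ m, σ (σ^[m] p) = σ^[k] p := by
  refine ⟨k + (orderOf σ - 1), ?_⟩
  have h : 0 < orderOf σ := orderOf_pos σ
  rw [← Function.iterate_succ_apply' σ, show (k + (orderOf σ - 1)).succ = k + orderOf σ by omega,
    Function.iterate_add_apply, perm_iterate_orderOf]

variable {C E : Type*} (f l : C → E)

/-- A set of elements that is closed under passing to the neighbours, all of which exist. -/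
def IsClosedFan (O : Set C) : Prop :=
  ∀ T ∈ O, (∃ T' ∈ O, f T' = l T) ∧ ∃ T' ∈ O, l T' = f T

variable {f l}

/-- The eigenvalue estimate at an interior node, where the triangles form a cycle. -/
lemma fan_estimate_cycle [Fintype C] (hl : Function.Injective l)
    (hnext : ∀ T, ∃ T', f T' = l T)
    (hO : ∀ O : Set C, O.Nonempty → IsClosedFan f l O → O = Set.univ)
    {x qf ql : C → ℝ} (hx : ∑ T, x T = 0)
    (hjump : ∀ T T', f T' = l T → (x T' - x T) ^ 2 ≤ (ql T + qf T') / 2)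
    {M : ℕ} (hM : Fintype.card C ≤ M) :
    4 * (1 - Real.cos (2 * Real.pi / M)) * ∑ T, x T ^ 2 ≤ ∑ T, (qf T + ql T) := by
  choose next hn using hnext
  have hinj : Function.Injective next := fun a b hab => hl (by rw [← hn a, ← hn b, hab])
  let τ : Equiv.Perm C := Equiv.ofBijective next (Finite.injective_iff_bijective.1 hinj)
  have hτ : ∀ T, f (τ T) = l T := hn
  -- The orbit of a triangle is a closed fan, hence everything: there is a single cycle.
  have horb : ∀ T, Set.range (fun k : ℕ => τ^[k] T) = Set.univ := by
    intro T
    refine hO _ ⟨T, 0, rfl⟩ ?_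
    rintro _ ⟨k, rfl⟩
    refine ⟨⟨_, ⟨k + 1, rfl⟩, ?_⟩, ?_⟩
    · dsimp only
      rw [Function.iterate_succ_apply', hτ]
    · obtain ⟨m, hm⟩ := exists_iterate_succ_eq τ T k
      exact ⟨_, ⟨m, rfl⟩, by dsimp only; rw [← hm, hτ]⟩
  have hw := perm_wirtinger τ x M (fun i => (minimalPeriod_le_card _ i).trans hM) (by
    intro T
    have h1 : ∀ T', ∑ k ∈ Finset.range (orderOf τ), x (τ^[k] T')
        = ∑ k ∈ Finset.range (orderOf τ), x (τ^[k] T) := by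
      intro T'
      obtain ⟨m, hm⟩ : T' ∈ Set.range (fun k : ℕ => τ^[k] T) := by rw [horb]; trivial
      dsimp only at hm
      rw [← hm, sum_orbit_iterate]
    have h2 := sum_iterate τ x (orderOf τ)
    rw [hx, mul_zero, Finset.sum_congr rfl fun T' _ => h1 T'] at h2
    simp only [Finset.sum_const, Finset.card_univ, nsmul_eq_mul] at h2
    have : Nonempty C := ⟨T⟩
    exact (mul_eq_zero.1 h2).resolve_left (by exact_mod_cast Fintype.card_ne_zero))
  -- Each shared side is charged once from either triangle, and `τ` only permutes the `qf` terms.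
  have hb : ∑ T, (x (τ T) - x T) ^ 2 ≤ ∑ T, (ql T + qf (τ T)) / 2 :=
    Finset.sum_le_sum fun T _ => hjump T (τ T) (hτ T)
  rw [← Finset.sum_div, Finset.sum_add_distrib, Equiv.sum_comp τ qf] at hb
  rw [Finset.sum_add_distrib]
  linarith

variable (f l) in
open Classical in
/-- The walk around the doubled fan, which turns round where there is no next triangle. -/
noncomputable def doubleStep : C × Bool → C × Bool
  | (T, true) => if h : ∃ T', f T' = l T then (h.choose, true) else (T, false)
  | (T, false) => if h : ∃ T', l T' = f T then (h.choose, false) else (T, true)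

lemma doubleStep_cases_true (T : C) :
    (∃ T', f T' = l T ∧ doubleStep f l (T, true) = (T', true)) ∨
      ((¬ ∃ T', f T' = l T) ∧ doubleStep f l (T, true) = (T, false)) := by
  by_cases h : ∃ T', f T' = l T
  · exact Or.inl ⟨h.choose, h.choose_spec, by simp only [doubleStep, dif_pos h]⟩
  · exact Or.inr ⟨h, by simp only [doubleStep, dif_neg h]⟩

lemma doubleStep_cases_false (T : C) :
    (∃ T', l T' = f T ∧ doubleStep f l (T, false) = (T', false)) ∨
      ((¬ ∃ T', l T' = f T) ∧ doubleStep f l (T, false) = (T, true)) := by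
  by_cases h : ∃ T', l T' = f T
  · exact Or.inl ⟨h.choose, h.choose_spec, by simp only [doubleStep, dif_pos h]⟩
  · exact Or.inr ⟨h, by simp only [doubleStep, dif_neg h]⟩

/-- The change of orientation. -/
def reverse (p : C × Bool) : C × Bool := (p.1, !p.2)

/-- Time reversal: a step taken after turning round undoes the previous step. This yields
injectivity of the walk and the cancellation of the odd extension along it. -/
lemma doubleStep_reverse (hf : Function.Injective f) (hl : Function.Injective l) (p : C × Bool) :
    doubleStep f l (reverse (doubleStep f l p)) = reverse p := by
  obtain ⟨T, b⟩ := p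
  cases b
  · rcases doubleStep_cases_false (f := f) (l := l) T with ⟨T', h, h'⟩ | ⟨h, h'⟩
    · rcases doubleStep_cases_true (f := f) (l := l) T' with ⟨S, k, k'⟩ | ⟨k, k'⟩
      · rw [h']
        simp only [reverse, Bool.not_false, k', hf (k.trans h)]
      · exact absurd ⟨T, h.symm⟩ k
    · rw [h']
      simp only [reverse, Bool.not_true, h', Bool.not_false]
  · rcases doubleStep_cases_true (f := f) (l := l) T with ⟨T', h, h'⟩ | ⟨h, h'⟩
    · rcases doubleStep_cases_false (f := f) (l := l) T' with ⟨S, k, k'⟩ | ⟨k, k'⟩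
      · rw [h']
        simp only [reverse, Bool.not_true, k', hl (k.trans h)]
      · exact absurd ⟨T, h.symm⟩ k
    · rw [h']
      simp only [reverse, Bool.not_true, h', Bool.not_false]

lemma reverse_reverse (p : C × Bool) : reverse (reverse p) = p := by simp [reverse]

lemma doubleStep_injective (hf : Function.Injective f) (hl : Function.Injective l) :
    Function.Injective (doubleStep f l) := by
  intro p q h
  have := doubleStep_reverse hf hl p
  rw [h, doubleStep_reverse hf hl q] at this
  rw [← reverse_reverse q, this, reverse_reverse]

/-- The eigenvalue estimate at a boundary node, where the triangles form paths. -/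
lemma fan_estimate_path [Fintype C] (hf : Function.Injective f) (hl : Function.Injective l)
    (hO : ∀ O : Set C, O.Nonempty → ¬ IsClosedFan f l O)
    {x qf ql : C → ℝ}
    (hjump : ∀ T T', f T' = l T → (x T' - x T) ^ 2 ≤ (ql T + qf T') / 2)
    (hendl : ∀ T, (¬ ∃ T', f T' = l T) → 4 * x T ^ 2 ≤ ql T)
    (hendf : ∀ T, (¬ ∃ T', l T' = f T) → 4 * x T ^ 2 ≤ qf T)
    {M : ℕ} (hM : Fintype.card C ≤ M) :
    4 * (1 - Real.cos (Real.pi / M)) * ∑ T, x T ^ 2 ≤ ∑ T, (qf T + ql T) := by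
  let σ : Equiv.Perm (C × Bool) := Equiv.ofBijective (doubleStep f l)
    (Finite.injective_iff_bijective.1 (doubleStep_injective hf hl))
  have hσ : ∀ p, σ p = doubleStep f l p := fun _ => rfl
  have hrev : ∀ k p, σ^[k] (reverse (σ^[k] p)) = reverse p := by
    intro k
    induction k with
    | zero => simp
    | succ k ih =>
      intro p
      rw [Function.iterate_succ_apply, Function.iterate_succ_apply', hσ (σ^[k] p), hσ,
        doubleStep_reverse hf hl, ih]
  -- The odd extension of `x` to the doubled fan.
  let y : C × Bool → ℝ := fun p => if p.2 then x p.1 else - x p.1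
  have hyrev : ∀ p, y (reverse p) = - y p := by
    rintro ⟨T, b⟩
    cases b <;> simp [y, reverse]
  let S : C × Bool → ℝ := fun p => ∑ k ∈ Finset.range (orderOf σ), y (σ^[k] p)
  have hS : ∀ p m, S (σ^[m] p) = S p := fun p m => sum_orbit_iterate σ y p m
  have hS1 : ∀ p, S (σ p) = S p := fun p => hS p 1
  have hPpos : 0 < orderOf σ := orderOf_pos σ
  -- Reversing the last point of a period and walking on visits the reversed points in the opposite
  -- order, and `y` is odd.
  have hSrev : ∀ p, S (reverse (σ^[orderOf σ - 1] p)) = - S p := by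
    intro p
    simp only [S]
    rw [← Finset.sum_range_reflect (fun k => y (σ^[k] p)), ← Finset.sum_neg_distrib]
    refine Finset.sum_congr rfl fun k hk => ?_
    have hk' := Finset.mem_range.1 hk
    rw [← hyrev, ← hrev k (σ^[orderOf σ - 1 - k] p), ← Function.iterate_add_apply,
      show k + (orderOf σ - 1 - k) = orderOf σ - 1 by omega]
  -- At a turn the reversed walk continues the walk itself, so the sum over a period equals its own
  -- negative.
  have hturn : ∀ r, σ r = reverse r → S r = 0 := by
    intro r hr
    have h1 := hSrev (σ r)
    rw [← Function.iterate_succ_apply, show (orderOf σ - 1).succ = orderOf σ by omega,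
      perm_iterate_orderOf, ← hr, hS1] at h1
    linarith
  -- Without a turn the orientation never changes, and the triangles visited form a closed fan,
  -- which is excluded. There may be several paths, so this is needed on every orbit.
  have hexists : ∀ p, ∃ k, σ (σ^[k] p) = reverse (σ^[k] p) := by
    rintro ⟨T, b⟩
    by_contra hcon
    push Not at hcon
    have hb : ∀ k, (σ^[k] (T, b)).2 = b := by
      intro k
      induction k with
      | zero => rfl
      | succ k ih =>
        have h1 := hcon k
        rw [Function.iterate_succ_apply']
        generalize σ^[k] (T, b) = p at h1 ih
        obtain ⟨R, c⟩ := p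
        obtain rfl : c = b := ih
        rw [hσ] at h1 ⊢
        cases c
        · rcases doubleStep_cases_false (f := f) (l := l) R with ⟨T', h, h'⟩ | ⟨h, h'⟩
          · rw [h']
          · exact absurd h' h1
        · rcases doubleStep_cases_true (f := f) (l := l) R with ⟨T', h, h'⟩ | ⟨h, h'⟩
          · rw [h']
          · exact absurd h' h1
    have hstep : ∀ k, σ^[k + 1] (T, b) = σ (σ^[k] (T, b)) :=
      fun k => Function.iterate_succ_apply' _ _ _
    refine hO (Set.range fun k => (σ^[k] (T, b)).1) ⟨_, 0, rfl⟩ ?_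
    have hadj : ∀ p : C × Bool, p.2 = b → (σ p).2 = b →
        (b = true → f (σ p).1 = l p.1) ∧ (b = false → l (σ p).1 = f p.1) := by
      rintro ⟨R, c⟩ h1 h2
      obtain rfl : c = b := h1
      rw [hσ] at h2 ⊢
      cases c
      · rcases doubleStep_cases_false (f := f) (l := l) R with ⟨T', h, h'⟩ | ⟨h, h'⟩
        · rw [h']; simpa using h
        · rw [h'] at h2; simp at h2
      · rcases doubleStep_cases_true (f := f) (l := l) R with ⟨T', h, h'⟩ | ⟨h, h'⟩
        · rw [h']; simpa using h
        · rw [h'] at h2; simp at h2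
    rintro _ ⟨k, rfl⟩
    have hk := hadj (σ^[k] (T, b)) (hb k) (by rw [← hstep]; exact hb _)
    obtain ⟨m, hm⟩ := exists_iterate_succ_eq σ (T, b) k
    have hk' := hadj (σ^[m] (T, b)) (hb m) (by rw [← hstep]; exact hb _)
    rw [hm] at hk'
    rw [← hstep] at hk
    cases b
    · exact ⟨⟨_, ⟨m, rfl⟩, (hk'.2 rfl).symm⟩, ⟨_, ⟨k + 1, rfl⟩, hk.2 rfl⟩⟩
    · exact ⟨⟨_, ⟨k + 1, rfl⟩, hk.1 rfl⟩, ⟨_, ⟨m, rfl⟩, (hk'.1 rfl).symm⟩⟩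
  -- The doubled fan has at most `2 * M` elements, which turns `2π` over the length into `π / M`.
  have hw := perm_wirtinger σ y (2 * M) (fun p => by
      refine (minimalPeriod_le_card _ p).trans ?_
      rw [Fintype.card_prod, Fintype.card_bool]
      omega) (by
    intro p
    obtain ⟨k, hk⟩ := hexists p
    have := hturn _ hk
    rwa [hS] at this)
  -- `Q` is the charge of the side through which the walk leaves and `Q'` that of the side through
  -- which it enters. At a turn both belong to the same side, so their average pays for the jump
  -- `2x` there.
  let Q : C × Bool → ℝ := fun p => if p.2 then ql p.1 else qf p.1
  let Q' : C × Bool → ℝ := fun p => if p.2 then qf p.1 else ql p.1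
  have hb : ∑ p, (y (σ p) - y p) ^ 2 ≤ ∑ p, (Q p + Q' (σ p)) / 2 := by
    refine Finset.sum_le_sum ?_
    rintro ⟨T, b⟩ -
    rw [hσ]
    cases b
    · rcases doubleStep_cases_false (f := f) (l := l) T with ⟨T', h, h'⟩ | ⟨h, h'⟩
      · have := hjump T' T h.symm
        simp only [h', y, Q, Q', Bool.false_eq_true, if_false]
        linarith
      · have := hendf T h
        simp only [h', y, Q, Q', Bool.false_eq_true, if_false, if_true]
        linarith
    · rcases doubleStep_cases_true (f := f) (l := l) T with ⟨T', h, h'⟩ | ⟨h, h'⟩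
      · have := hjump T T' h
        simp only [h', y, Q, Q', if_true]
        linarith
      · have := hendl T h
        simp only [h', y, Q, Q', Bool.false_eq_true, if_false, if_true]
        linarith
  rw [← Finset.sum_div, Finset.sum_add_distrib, Equiv.sum_comp σ Q'] at hb
  have e1 : ∑ p, y p ^ 2 = 2 * ∑ T, x T ^ 2 := by
    rw [Fintype.sum_prod_type, Finset.mul_sum]
    refine Finset.sum_congr rfl fun T _ => ?_
    simp [y, two_mul]
  have e2 : ∑ p, Q p = ∑ T, (qf T + ql T) := by
    rw [Fintype.sum_prod_type]
    refine Finset.sum_congr rfl fun T _ => ?_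
    simp [Q, add_comm]
  have e3 : ∑ p, Q' p = ∑ T, (qf T + ql T) := by
    rw [Fintype.sum_prod_type]
    refine Finset.sum_congr rfl fun T _ => ?_
    simp [Q']
  have e4 : 2 * Real.pi / ((2 * M : ℕ) : ℝ) = Real.pi / M := by
    push_cast
    rw [mul_div_mul_left _ _ two_ne_zero]
  rw [e4] at hw
  rw [e2, e3] at hb
  rw [e1] at hw
  linarith

end Fan

/-! ### Cross products and barycentric coordinates. -/

section Cross

/-- The cross product in the plane. -/
def cross (u w : Plane) : ℝ := u 0 * w 1 - u 1 * w 0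

/-- Cramer's rule in the plane. -/
lemma cross_smul_eq (u w x : Plane) : cross u w • x = cross x w • u + cross u x • w := by
  ext i
  fin_cases i <;> simp [cross] <;> ring

lemma cross_comm (u w : Plane) : cross w u = - cross u w := by simp [cross]; ring

lemma cross_self (u : Plane) : cross u u = 0 := by simp [cross]; ring

lemma cross_zero_left (u : Plane) : cross 0 u = 0 := by simp [cross]

lemma cross_zero_right (u : Plane) : cross u 0 = 0 := by simp [cross]

lemma cross_add_left (u w x : Plane) : cross (u + w) x = cross u x + cross w x := by
  simp [cross]; ring

lemma cross_add_right (u w x : Plane) : cross x (u + w) = cross x u + cross x w := by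
  simp [cross]; ring

lemma cross_smul_left (c : ℝ) (u w : Plane) : cross (c • u) w = c * cross u w := by
  simp [cross]; ring

lemma cross_smul_right (c : ℝ) (u w : Plane) : cross u (c • w) = c * cross u w := by
  simp [cross]; ring

lemma continuous_cross_left (w : Plane) : Continuous fun u => cross u w := by
  unfold cross; fun_prop

lemma continuous_cross_right (w : Plane) : Continuous fun u => cross w u := by
  unfold cross; fun_prop

lemma cross_sq_add_inner_sq (u w : Plane) :
    cross u w ^ 2 + inner ℝ u w ^ 2 = ‖u‖ ^ 2 * ‖w‖ ^ 2 := by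
  simp only [EuclideanSpace.norm_sq_eq, PiLp.inner_apply, Fin.sum_univ_two, cross,
    Real.norm_eq_abs, sq_abs, RCLike.inner_apply, conj_trivial]
  ring

/-- The first barycentric coordinate in the triangle `z a b`. -/
noncomputable def baryA (z a b x : Plane) : ℝ := cross (x - z) (b - z) / cross (a - z) (b - z)

/-- The second barycentric coordinate in the triangle `z a b`. -/
noncomputable def baryB (z a b x : Plane) : ℝ := cross (a - z) (x - z) / cross (a - z) (b - z)

lemma continuous_baryA (z a b : Plane) : Continuous (baryA z a b) :=
  ((continuous_cross_left _).comp (continuous_id.sub continuous_const)).div_const _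

lemma continuous_baryB (z a b : Plane) : Continuous (baryB z a b) :=
  ((continuous_cross_right _).comp (continuous_id.sub continuous_const)).div_const _

lemma eq_add_bary {z a b : Plane} (h : cross (a - z) (b - z) ≠ 0) (x : Plane) :
    x = z + (baryA z a b x • (a - z) + baryB z a b x • (b - z)) := by
  have h1 := cross_smul_eq (a - z) (b - z) (x - z)
  have h2 : x - z = baryA z a b x • (a - z) + baryB z a b x • (b - z) := by
    rw [baryA, baryB, div_eq_inv_mul, div_eq_inv_mul, mul_smul, mul_smul, ← smul_add, ← h1,
      smul_smul, inv_mul_cancel₀ h, one_smul]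
  rw [← h2]; abel

lemma baryA_add {z a b : Plane} (h : cross (a - z) (b - z) ≠ 0) (s t : ℝ) :
    baryA z a b (z + (s • (a - z) + t • (b - z))) = s := by
  rw [baryA, add_sub_cancel_left, cross_add_left, cross_smul_left, cross_smul_left, cross_self,
    mul_zero, add_zero, mul_div_assoc, div_self h, mul_one]

lemma baryB_add {z a b : Plane} (h : cross (a - z) (b - z) ≠ 0) (s t : ℝ) :
    baryB z a b (z + (s • (a - z) + t • (b - z))) = t := by
  rw [baryB, add_sub_cancel_left, cross_add_right, cross_smul_right, cross_smul_right, cross_self,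
    mul_zero, zero_add, mul_div_assoc, div_self h, mul_one]

lemma mem_convexHull_triple {z a b x : Plane} :
    x ∈ convexHull ℝ {z, a, b} ↔
      ∃ s t : ℝ, 0 ≤ s ∧ 0 ≤ t ∧ s + t ≤ 1 ∧ x = z + (s • (a - z) + t • (b - z)) := by
  rw [convexHull_insert (Set.insert_nonempty _ _), mem_convexJoin]
  simp only [convexHull_pair, Set.mem_singleton_iff, exists_eq_left]
  constructor
  · rintro ⟨y, hy, hx⟩
    rw [segment_eq_image'] at hy hx
    obtain ⟨r, hr, rfl⟩ := hy
    obtain ⟨c, hc, rfl⟩ := hx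
    refine ⟨c * (1 - r), c * r, mul_nonneg hc.1 (by linarith [hr.2]), mul_nonneg hc.1 hr.1,
      by linarith [hc.2], ?_⟩
    module
  · rintro ⟨s, t, hs, ht, hst, rfl⟩
    -- The ray from `z` meets the opposite side at the parameter `t / (s + t)`. If `s + t = 0` the
    -- point is `z` itself and any point of that side serves.
    rcases eq_or_lt_of_le (add_nonneg hs ht) with h | h
    · have hs0 : s = 0 := by linarith
      have ht0 : t = 0 := by linarith
      refine ⟨a, left_mem_segment _ _ _, ?_⟩
      simp [hs0, ht0, left_mem_segment]
    · refine ⟨a + (t / (s + t)) • (b - a), ?_, ?_⟩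
      · rw [segment_eq_image']
        exact ⟨_, ⟨by positivity, (div_le_one h).2 (by linarith)⟩, rfl⟩
      · rw [segment_eq_image']
        refine ⟨s + t, ⟨h.le, hst⟩, ?_⟩
        have : t = (s + t) * (t / (s + t)) := by field_simp
        dsimp only
        have h2 : (s + t) • (a + (t / (s + t)) • (b - a) - z)
            = (s + t) • (a - z) + ((s + t) * (t / (s + t))) • (b - a) := by module
        rw [h2, ← this]
        module

lemma mem_convexHull_triple_iff {z a b : Plane} (h : cross (a - z) (b - z) ≠ 0) (x : Plane) :
    x ∈ convexHull ℝ {z, a, b} ↔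
      0 ≤ baryA z a b x ∧ 0 ≤ baryB z a b x ∧ baryA z a b x + baryB z a b x ≤ 1 := by
  rw [mem_convexHull_triple]
  constructor
  · rintro ⟨s, t, hs, ht, hst, rfl⟩
    rw [baryA_add h, baryB_add h]
    exact ⟨hs, ht, hst⟩
  · rintro ⟨h1, h2, h3⟩
    exact ⟨_, _, h1, h2, h3, eq_add_bary h x⟩

lemma mem_interior_convexHull_triple {z a b : Plane} (h : cross (a - z) (b - z) ≠ 0) {x : Plane}
    (hA : 0 < baryA z a b x) (hB : 0 < baryB z a b x) (hAB : baryA z a b x + baryB z a b x < 1) :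
    x ∈ interior (convexHull ℝ {z, a, b}) := by
  rw [mem_interior_iff_mem_nhds]
  filter_upwards [(continuous_baryA z a b).continuousAt.eventually (lt_mem_nhds hA),
    (continuous_baryB z a b).continuousAt.eventually (lt_mem_nhds hB),
    ((continuous_baryA z a b).add (continuous_baryB z a b)).continuousAt.eventually
      (gt_mem_nhds hAB)] with y h1 h2 h3
  exact (mem_convexHull_triple_iff h y).2 ⟨h1.le, h2.le, h3.le⟩

lemma affineMap_apply_bary (p : Plane →ᵃ[ℝ] ℝ) (z a b : Plane) (s t : ℝ) :
    p (z + (s • (a - z) + t • (b - z))) = (1 - s - t) * p z + s * p a + t * p b := by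
  have h1 : ∀ y, p y = p.linear (y - z) + p z := by
    intro y
    have := p.map_vadd z (y - z)
    simpa using this
  rw [h1, h1 a, h1 b, add_sub_cancel_left, map_add, map_smul, map_smul]
  simp only [smul_eq_mul]
  ring

end Cross

/-! ### Integrals over a triangle. -/

section Area

/-- The reference triangle. -/
def refTriangle : Set Plane := {x | 0 ≤ x 0 ∧ 0 ≤ x 1 ∧ x 0 + x 1 ≤ 1}

/-- The linear map that takes the unit vectors to `u` and `w`. -/
noncomputable def frameMap (u w : Plane) : Plane →L[ℝ] Plane :=
  (EuclideanSpace.proj (0 : Fin 2)).smulRight u + (EuclideanSpace.proj (1 : Fin 2)).smulRight w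

lemma frameMap_apply (u w x : Plane) : frameMap u w x = x 0 • u + x 1 • w := by
  simp [frameMap]

lemma det_frameMap (u w : Plane) : (frameMap u w).det = cross u w := by
  have : (frameMap u w).det = LinearMap.det (frameMap u w : Plane →ₗ[ℝ] Plane) := rfl
  rw [this, ← LinearMap.det_toMatrix (EuclideanSpace.basisFun (Fin 2) ℝ).toBasis,
    Matrix.det_fin_two]
  simp [LinearMap.toMatrix_apply, frameMap_apply, cross]
  ring

lemma isClosed_refTriangle : IsClosed refTriangle := by
  have h0 : IsClosed {x : Plane | 0 ≤ x 0} := isClosed_le continuous_const (by fun_prop)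
  have h1 : IsClosed {x : Plane | 0 ≤ x 1} := isClosed_le continuous_const (by fun_prop)
  have h2 : IsClosed {x : Plane | x 0 + x 1 ≤ 1} := isClosed_le (by fun_prop) continuous_const
  exact h0.inter (h1.inter h2)

lemma measurableSet_prodTriangle :
    MeasurableSet {p : ℝ × ℝ | 0 ≤ p.1 ∧ 0 ≤ p.2 ∧ p.1 + p.2 ≤ 1} := by
  have h0 : IsClosed {p : ℝ × ℝ | 0 ≤ p.1} := isClosed_le continuous_const (by fun_prop)
  have h1 : IsClosed {p : ℝ × ℝ | 0 ≤ p.2} := isClosed_le continuous_const (by fun_prop)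
  have h2 : IsClosed {p : ℝ × ℝ | p.1 + p.2 ≤ 1} := isClosed_le (by fun_prop) continuous_const
  exact (h0.inter (h1.inter h2)).measurableSet

lemma image_refTriangle (z a b : Plane) :
    (fun x => z + frameMap (a - z) (b - z) x) '' refTriangle = convexHull ℝ {z, a, b} := by
  ext y
  rw [mem_convexHull_triple]
  constructor
  · rintro ⟨x, ⟨h1, h2, h3⟩, rfl⟩
    exact ⟨x 0, x 1, h1, h2, h3, by dsimp only; rw [frameMap_apply]⟩
  · rintro ⟨s, t, h1, h2, h3, rfl⟩
    refine ⟨!₂[s, t], ⟨by simpa using h1, by simpa using h2, by simpa using h3⟩, ?_⟩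
    dsimp only
    rw [frameMap_apply]
    simp

lemma lintegral_convexHull_triple {z a b : Plane} (h : cross (a - z) (b - z) ≠ 0)
    (g : Plane → ℝ≥0∞) :
    ∫⁻ x in convexHull ℝ {z, a, b}, g x
      = ∫⁻ x in refTriangle, ENNReal.ofReal |cross (a - z) (b - z)|
          * g (z + frameMap (a - z) (b - z) x) := by
  rw [← image_refTriangle, lintegral_image_eq_lintegral_abs_det_fderiv_mul volume
    isClosed_refTriangle.measurableSet
    (f' := fun _ => frameMap (a - z) (b - z))]
  · simp only [det_frameMap]
  · intro x _
    exact ((frameMap (a - z) (b - z)).hasFDerivAt.const_add z).hasFDerivWithinAt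
  · intro x _ y _ hxy
    have hxy' : z + frameMap (a - z) (b - z) x = z + frameMap (a - z) (b - z) y := hxy
    rw [frameMap_apply, frameMap_apply] at hxy'
    have e0 := congrArg (baryA z a b) hxy'
    have e1 := congrArg (baryB z a b) hxy'
    rw [baryA_add h, baryA_add h] at e0
    rw [baryB_add h, baryB_add h] at e1
    ext i
    fin_cases i
    · exact e0
    · exact e1

lemma measurePreserving_coords :
    MeasurePreserving (fun x : Plane => (x 0, x 1)) volume (volume.prod volume) :=
  (volume_preserving_finTwoArrow ℝ).comp
    (EuclideanSpace.volume_preserving_symm_measurableEquiv_toLp (Fin 2))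

lemma lintegral_refTriangle_prod {g : ℝ × ℝ → ℝ≥0∞} (hg : Measurable g) :
    ∫⁻ x in refTriangle, g (x 0, x 1)
      = ∫⁻ s, ∫⁻ t, {p : ℝ × ℝ | 0 ≤ p.1 ∧ 0 ≤ p.2 ∧ p.1 + p.2 ≤ 1}.indicator g (s, t) := by
  have hm := measurableSet_prodTriangle
  rw [← lintegral_prod _ (hg.indicator hm).aemeasurable,
    ← measurePreserving_coords.lintegral_comp (hg.indicator hm),
    ← lintegral_indicator isClosed_refTriangle.measurableSet]
  rfl

lemma lintegral_refTriangle_fst {f : ℝ → ℝ} (hf : Continuous f) (hf0 : ∀ s, 0 ≤ s → 0 ≤ f s) :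
    ∫⁻ x in refTriangle, ENNReal.ofReal (f (x 0))
      = ENNReal.ofReal (∫ s in (0 : ℝ)..1, f s * (1 - s)) := by
  rw [lintegral_refTriangle_prod (g := fun p => ENNReal.ofReal (f p.1)) (by fun_prop)]
  -- The slice at `s` has length `1 - s`. The point `s = 0` belongs to the triangle but not to `Ioc
  -- 0 1`; it is set aside and later discarded as a null set.
  have h1 : ∀ s : ℝ, ∫⁻ t, {p : ℝ × ℝ | 0 ≤ p.1 ∧ 0 ≤ p.2 ∧ p.1 + p.2 ≤ 1}.indicator
      (fun p => ENNReal.ofReal (f p.1)) (s, t)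
      = (Set.Ioc (0 : ℝ) 1).indicator (fun s => ENNReal.ofReal (f s * (1 - s))) s
        ∨ s = 0 := by
    intro s
    by_cases hs0 : s = 0
    · exact Or.inr hs0
    left
    by_cases hs : s ∈ Set.Ioc (0 : ℝ) 1
    · rw [Set.indicator_of_mem hs, ENNReal.ofReal_mul (hf0 s hs.1.le),
        ← sub_zero (1 - s), ← Real.volume_Icc, ← lintegral_indicator_const measurableSet_Icc]
      refine lintegral_congr fun t => ?_
      by_cases ht : t ∈ Set.Icc (0 : ℝ) (1 - s)
      · rw [Set.indicator_of_mem ht, Set.indicator_of_mem]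
        exact ⟨hs.1.le, ht.1, by dsimp only; linarith [ht.2]⟩
      · rw [Set.indicator_of_notMem ht, Set.indicator_of_notMem]
        rintro ⟨_, h2, h3⟩
        dsimp only at h2 h3
        exact ht ⟨h2, by linarith⟩
    · rw [Set.indicator_of_notMem hs]
      refine (lintegral_congr fun t => ?_).trans lintegral_zero
      rw [Set.indicator_of_notMem]
      rintro ⟨h2, h3, h4⟩
      dsimp only at h2 h3 h4
      exact hs ⟨lt_of_le_of_ne h2 (Ne.symm hs0), by linarith⟩
  have h2 : (fun s : ℝ => ∫⁻ t, {p : ℝ × ℝ | 0 ≤ p.1 ∧ 0 ≤ p.2 ∧ p.1 + p.2 ≤ 1}.indicator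
      (fun p => ENNReal.ofReal (f p.1)) (s, t))
      =ᵐ[volume] (Set.Ioc (0 : ℝ) 1).indicator (fun s => ENNReal.ofReal (f s * (1 - s))) := by
    filter_upwards [compl_mem_ae_iff.2 (measure_singleton (0 : ℝ))] with s hs
    exact (h1 s).resolve_right hs
  rw [lintegral_congr_ae h2, lintegral_indicator measurableSet_Ioc,
    intervalIntegral.integral_of_le zero_le_one, ofReal_integral_eq_lintegral_ofReal]
  · exact (Continuous.intervalIntegrable (by fun_prop) 0 1).1
  · filter_upwards [ae_restrict_mem measurableSet_Ioc] with s hs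
    exact mul_nonneg (hf0 s hs.1.le) (by linarith [hs.2])

lemma volume_refTriangle : volume refTriangle = ENNReal.ofReal (1 / 2) := by
  have := lintegral_refTriangle_fst (f := fun _ => 1) continuous_const (fun _ _ => zero_le_one)
  simp only [ENNReal.ofReal_one, lintegral_one, Measure.restrict_apply_univ] at this
  rw [this]
  congr 1
  simp only [one_mul]
  rw [intervalIntegral.integral_sub (by simp) (by simp)]
  simp
  norm_num

lemma lintegral_refTriangle_zero :
    ∫⁻ x in refTriangle, ENNReal.ofReal (x 0) = ENNReal.ofReal (1 / 6) := by
  rw [lintegral_refTriangle_fst (f := fun s => s) continuous_id (fun _ h => h)]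
  congr 1
  have : ∀ s : ℝ, s * (1 - s) = s - s ^ 2 := fun s => by ring
  simp only [this]
  rw [intervalIntegral.integral_sub (by simp) (by simp)]
  simp
  norm_num

lemma lintegral_refTriangle_one :
    ∫⁻ x in refTriangle, ENNReal.ofReal (x 1) = ENNReal.ofReal (1 / 6) := by
  rw [← lintegral_refTriangle_zero]
  rw [lintegral_refTriangle_prod (g := fun p => ENNReal.ofReal p.2) (by fun_prop),
    lintegral_refTriangle_prod (g := fun p => ENNReal.ofReal p.1) (by fun_prop),
    lintegral_lintegral_swap]
  · refine lintegral_congr fun s => lintegral_congr fun t => ?_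
    simp only [Set.indicator]
    refine if_congr ?_ rfl rfl
    simp only [Set.mem_ofPred_eq]
    constructor <;> rintro ⟨h1, h2, h3⟩ <;> exact ⟨h2, h1, by linarith⟩
  · exact (Measurable.indicator (by fun_prop) measurableSet_prodTriangle).aemeasurable

/-- The three barycentric coordinates add up to one, so this integral is what remains: `1/2 - 1/6 -
1/6`. -/
lemma lintegral_refTriangle_compl :
    ∫⁻ x in refTriangle, ENNReal.ofReal (1 - x 0 - x 1) = ENNReal.ofReal (1 / 6) := by
  have h : (∫⁻ x in refTriangle, ENNReal.ofReal (1 - x 0 - x 1))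
      + ((∫⁻ x in refTriangle, ENNReal.ofReal (x 0)) + ∫⁻ x in refTriangle, ENNReal.ofReal (x 1))
      = ENNReal.ofReal (1 / 2) := by
    rw [← lintegral_add_left (by fun_prop), ← lintegral_add_left (by fun_prop),
      ← volume_refTriangle, ← setLIntegral_one]
    refine setLIntegral_congr_fun isClosed_refTriangle.measurableSet ?_
    rintro x ⟨h1, h2, h3⟩
    dsimp only
    rw [← ENNReal.ofReal_add h1 h2, ← ENNReal.ofReal_add (by linarith) (by linarith)]
    simp
  rw [lintegral_refTriangle_zero, lintegral_refTriangle_one, ← ENNReal.ofReal_add (by norm_num)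
    (by norm_num), show (1 : ℝ) / 2 = 1 / 6 + (1 / 6 + 1 / 6) by norm_num,
    ENNReal.ofReal_add (p := 1 / 6) (q := 1 / 6 + 1 / 6) (by norm_num) (by norm_num)] at h
  exact (ENNReal.add_left_inj ENNReal.ofReal_ne_top).1 h

lemma volume_convexHull_triple {z a b : Plane} (h : cross (a - z) (b - z) ≠ 0) :
    volume (convexHull ℝ {z, a, b}) = ENNReal.ofReal (|cross (a - z) (b - z)| / 2) := by
  rw [← setLIntegral_one, lintegral_convexHull_triple h]
  simp only [mul_one, lintegral_const, Measure.restrict_apply_univ, volume_refTriangle]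
  rw [← ENNReal.ofReal_mul (abs_nonneg _)]
  congr 1
  ring

/-- The `L²` norm of an affine function on a triangle, bounded by its nodal values. -/
lemma lintegral_affine_sq_le {z a b : Plane} (h : cross (a - z) (b - z) ≠ 0)
    (p : Plane →ᵃ[ℝ] ℝ) :
    ∫⁻ x in convexHull ℝ {z, a, b}, ENNReal.ofReal (p x ^ 2)
      ≤ ENNReal.ofReal (|cross (a - z) (b - z)| / 6 * (p z ^ 2 + p a ^ 2 + p b ^ 2)) := by
  rw [lintegral_convexHull_triple h, lintegral_const_mul' _ _ ENNReal.ofReal_ne_top, div_eq_mul_inv,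
    mul_assoc, ENNReal.ofReal_mul (abs_nonneg _)]
  gcongr
  -- Convexity of the square: the value at `x` is a convex combination of the nodal values. Each
  -- barycentric coordinate then integrates to `1/6`.
  have hle : ∀ x ∈ refTriangle, ENNReal.ofReal (p (z + frameMap (a - z) (b - z) x) ^ 2)
      ≤ ENNReal.ofReal (1 - x 0 - x 1) * ENNReal.ofReal (p z ^ 2)
        + (ENNReal.ofReal (x 0) * ENNReal.ofReal (p a ^ 2)
        + ENNReal.ofReal (x 1) * ENNReal.ofReal (p b ^ 2)) := by
    rintro x ⟨h1, h2, h3⟩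
    have h4 : 0 ≤ 1 - x 0 - x 1 := by linarith
    rw [← ENNReal.ofReal_mul h1, ← ENNReal.ofReal_mul h2, ← ENNReal.ofReal_mul h4,
      ← ENNReal.ofReal_add (by positivity) (by positivity),
      ← ENNReal.ofReal_add (by positivity) (by positivity)]
    refine ENNReal.ofReal_le_ofReal ?_
    rw [frameMap_apply, affineMap_apply_bary]
    nlinarith [mul_nonneg (mul_nonneg h4 h1) (sq_nonneg (p z - p a)),
      mul_nonneg (mul_nonneg h4 h2) (sq_nonneg (p z - p b)),
      mul_nonneg (mul_nonneg h1 h2) (sq_nonneg (p a - p b))]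
  refine (setLIntegral_mono (by fun_prop) hle).trans ?_
  rw [lintegral_add_left (by fun_prop), lintegral_add_left (by fun_prop),
    lintegral_mul_const _ (by fun_prop), lintegral_mul_const _ (by fun_prop),
    lintegral_mul_const _ (by fun_prop), lintegral_refTriangle_zero, lintegral_refTriangle_one,
    lintegral_refTriangle_compl, ← mul_add, ← mul_add, ← ENNReal.ofReal_add (by positivity)
    (by positivity), ← ENNReal.ofReal_add (by positivity) (by positivity),
    ← ENNReal.ofReal_mul (by norm_num)]
  refine ENNReal.ofReal_le_ofReal (le_of_eq ?_)
  ring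

end Area

/-! ### Angles, side lengths and area. -/

section Angles

/-- With `θ` the angle between `u` and `w`, this is the monotonicity `cot θ ≤ cot ω₀`; after
clearing the sines it reads `sin (θ - ω₀) ≥ 0`. -/
lemma inner_le_cross_mul_cot {ω₀ : ℝ} (h0 : 0 < ω₀) {u w : Plane}
    (h : ω₀ ≤ InnerProductGeometry.angle u w) (hD : cross u w ≠ 0) :
    inner ℝ u w ≤ |cross u w| * Real.cot ω₀ := by
  set θ := InnerProductGeometry.angle u w with hθ
  have hcos := InnerProductGeometry.cos_angle_mul_norm_mul_norm u w
  have hsin := InnerProductGeometry.sin_angle_mul_norm_mul_norm u w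
  have hcr : |cross u w| = Real.sin θ * (‖u‖ * ‖w‖) := by
    rw [hsin, ← Real.sqrt_sq_eq_abs]
    congr 1
    rw [real_inner_self_eq_norm_sq, real_inner_self_eq_norm_sq, ← cross_sq_add_inner_sq]
    ring
  have hpos : 0 < |cross u w| := abs_pos.2 hD
  have hn : 0 ≤ ‖u‖ * ‖w‖ := by positivity
  have hθπ : θ ≤ Real.pi := InnerProductGeometry.angle_le_pi u w
  have hθne : θ ≠ Real.pi := by
    intro hc
    rw [hcr, hc, Real.sin_pi, zero_mul] at hpos
    exact lt_irrefl _ hpos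
  have hs0 : 0 < Real.sin ω₀ :=
    Real.sin_pos_of_pos_of_lt_pi h0 (lt_of_le_of_lt h (lt_of_le_of_ne hθπ hθne))
  have hsub : 0 ≤ Real.sin (θ - ω₀) :=
    Real.sin_nonneg_of_nonneg_of_le_pi (by linarith) (by linarith)
  rw [Real.sin_sub] at hsub
  rw [Real.cot_eq_cos_div_sin, mul_div_assoc', le_div_iff₀ hs0, ← hcos, hcr]
  calc Real.cos θ * (‖u‖ * ‖w‖) * Real.sin ω₀ = (Real.cos θ * Real.sin ω₀) * (‖u‖ * ‖w‖) := by ring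
    _ ≤ (Real.sin θ * Real.cos ω₀) * (‖u‖ * ‖w‖) :=
        mul_le_mul_of_nonneg_right (by linarith) hn
    _ = _ := by ring

lemma cross_rotate (z a b : Plane) : cross (b - a) (z - a) = cross (a - z) (b - z) := by
  simp [cross]; ring

/-- The squared sides add up to twice the sum of the inner products at the three vertices, and the
cross product is the same at each vertex. -/
lemma sum_sq_sides_le {ω₀ : ℝ} (h0 : 0 < ω₀) {z a b : Plane} (hD : 0 < cross (a - z) (b - z))
    (hz : ω₀ ≤ EuclideanGeometry.angle a z b) (ha : ω₀ ≤ EuclideanGeometry.angle b a z)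
    (hb : ω₀ ≤ EuclideanGeometry.angle z b a) :
    ‖a - z‖ ^ 2 + ‖b - z‖ ^ 2 + ‖b - a‖ ^ 2 ≤ 6 * cross (a - z) (b - z) * Real.cot ω₀ := by
  have h1 := inner_le_cross_mul_cot h0 (u := a - z) (w := b - z) hz hD.ne'
  have h2 := inner_le_cross_mul_cot h0 (u := b - a) (w := z - a) ha
    (by rw [cross_rotate]; exact hD.ne')
  have h3 := inner_le_cross_mul_cot h0 (u := z - b) (w := a - b) hb
    (by rw [cross_rotate, cross_rotate]; exact hD.ne')
  rw [cross_rotate, cross_rotate] at h3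
  rw [cross_rotate] at h2
  rw [abs_of_pos hD] at h1 h2 h3
  have e : ‖a - z‖ ^ 2 + ‖b - z‖ ^ 2 + ‖b - a‖ ^ 2
      = 2 * (inner ℝ (a - z) (b - z) + inner ℝ (b - a) (z - a) + inner ℝ (z - b) (a - b)) := by
    simp only [EuclideanSpace.norm_sq_eq, PiLp.inner_apply, Fin.sum_univ_two,
      Real.norm_eq_abs, sq_abs, RCLike.inner_apply, conj_trivial, PiLp.sub_apply]
    ring
  rw [e]
  linarith

/-- Weitzenböck's inequality. -/
lemma cross_le_sum_sq_sides (z a b : Plane) :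
    2 * Real.sqrt 3 * cross (a - z) (b - z) ≤ ‖a - z‖ ^ 2 + ‖b - z‖ ^ 2 + ‖b - a‖ ^ 2 := by
  simp only [EuclideanSpace.norm_sq_eq, Fin.sum_univ_two, Real.norm_eq_abs, sq_abs, cross,
    PiLp.sub_apply]
  have h3 : Real.sqrt 3 ^ 2 = 3 := Real.sq_sqrt (by norm_num)
  set r := Real.sqrt 3
  -- The difference of the two sides is twice the squared distance of `b` from the apex of the
  -- equilateral triangle over `z` and `a`.
  nlinarith [sq_nonneg ((b 0 - z 0) - (a 0 - z 0) / 2 + r / 2 * (a 1 - z 1)),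
    sq_nonneg ((b 1 - z 1) - (a 1 - z 1) / 2 - r / 2 * (a 0 - z 0))]

end Angles

/-! ### Oriented triangles and the local geometry at a side. -/

section Frames

/-- The vertices of the triangle `T` are `z`, `a`, `b` in counterclockwise order. -/
def IsFrame (T : Finset Plane) (z a b : Plane) : Prop :=
  (T : Set Plane) = {z, a, b} ∧ 0 < cross (a - z) (b - z)

namespace IsFrame

variable {T : Finset Plane} {z a b : Plane}

lemma hull_eq (h : IsFrame T z a b) : hull T = convexHull ℝ {z, a, b} := by
  rw [hull, h.1]

lemma rotate (h : IsFrame T z a b) : IsFrame T a b z := by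
  refine ⟨?_, by rw [cross_rotate]; exact h.2⟩
  rw [h.1]
  ext x
  simp only [Set.mem_insert_iff, Set.mem_singleton_iff]
  tauto

lemma mem_iff (h : IsFrame T z a b) {x : Plane} : x ∈ T ↔ x = z ∨ x = a ∨ x = b := by
  rw [← Finset.mem_coe, h.1]; simp

lemma fst_mem (h : IsFrame T z a b) : z ∈ T := h.mem_iff.2 (Or.inl rfl)

lemma snd_mem (h : IsFrame T z a b) : a ∈ T := h.rotate.fst_mem

lemma thd_mem (h : IsFrame T z a b) : b ∈ T := h.rotate.snd_mem

lemma snd_ne (h : IsFrame T z a b) : a ≠ z := by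
  rintro rfl
  have := h.2
  rw [sub_self, cross_zero_left] at this
  exact lt_irrefl _ this

lemma thd_ne_snd (h : IsFrame T z a b) : b ≠ a := h.rotate.snd_ne

lemma thd_ne (h : IsFrame T z a b) : b ≠ z := h.rotate.rotate.snd_ne.symm

lemma unique {c d : Plane} (h : IsFrame T z a b) (h' : IsFrame T z c d) : c = a ∧ d = b := by
  have hc := (h.mem_iff.1 h'.snd_mem).resolve_left h'.snd_ne
  have hd := (h.mem_iff.1 h'.thd_mem).resolve_left h'.thd_ne
  have hcd := h'.thd_ne_snd
  rcases hc with rfl | rfl <;> rcases hd with rfl | rfl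
  · exact absurd rfl hcd
  · exact ⟨rfl, rfl⟩
  · have h1 := h.2
    have h2 := h'.2
    rw [cross_comm] at h2
    linarith
  · exact absurd rfl hcd

lemma sum_eq (h : IsFrame T z a b) (g : Plane → ℝ) : ∑ y ∈ T, g y = g z + (g a + g b) := by
  classical
  have : T = {z, a, b} := Finset.coe_injective (by rw [h.1]; simp)
  rw [this, Finset.sum_insert, Finset.sum_pair h.thd_ne_snd.symm]
  simp [h.snd_ne.symm, h.thd_ne.symm]

lemma mem_hull_iff (h : IsFrame T z a b) (x : Plane) :
    x ∈ hull T ↔ 0 ≤ baryA z a b x ∧ 0 ≤ baryB z a b x ∧ baryA z a b x + baryB z a b x ≤ 1 := by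
  rw [h.hull_eq, mem_convexHull_triple_iff h.2.ne']

lemma mem_interior_hull (h : IsFrame T z a b) {x : Plane} (hA : 0 < baryA z a b x)
    (hB : 0 < baryB z a b x) (hAB : baryA z a b x + baryB z a b x < 1) :
    x ∈ interior (hull T) := by
  rw [h.hull_eq]
  exact mem_interior_convexHull_triple h.2.ne' hA hB hAB

end IsFrame

lemma isClosed_hull (T : Finset Plane) : IsClosed (hull T) :=
  T.finite_toSet.isClosed_convexHull (𝕜 := ℝ)

lemma isCompact_hull (T : Finset Plane) : IsCompact (hull T) :=
  T.finite_toSet.isCompact_convexHull (𝕜 := ℝ)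

lemma convex_hull (T : Finset Plane) : Convex ℝ (hull T) := convex_convexHull ℝ _

lemma subset_hull {T : Finset Plane} {x : Plane} (h : x ∈ T) : x ∈ hull T :=
  subset_convexHull ℝ _ h

lemma cross_ne_zero_of_affineIndependent {z a b : Plane}
    (h : AffineIndependent ℝ ![z, a, b]) : cross (a - z) (b - z) ≠ 0 := by
  intro hD
  rw [affineIndependent_iff_linearIndependent_vsub ℝ _ (0 : Fin 3)] at h
  have hinj : Function.Injective
      (![⟨1, by decide⟩, ⟨2, by decide⟩] : Fin 2 → {x : Fin 3 // x ≠ 0}) := by decide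
  have h2 := h.comp _ hinj
  have h3 : LinearIndependent ℝ ![a - z, b - z] := by
    have he : ![a - z, b - z] = (fun i : {x : Fin 3 // x ≠ 0} =>
        ![z, a, b] (i : Fin 3) -ᵥ ![z, a, b] 0) ∘ ![⟨1, by decide⟩, ⟨2, by decide⟩] := by
      ext i j
      fin_cases i <;> simp
    rw [he]
    exact h2
  rw [LinearIndependent.pair_iff] at h3
  -- A vanishing cross product gives linear relations whose coefficients are coordinates of the two
  -- vectors. Independence then forces `a - z = 0`, a contradiction.
  have e1 := h3 ((b - z) 1) (-(a - z) 1) (by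
    ext i
    fin_cases i
    · simp only [cross] at hD
      simp at hD ⊢
      linarith
    · simp; ring)
  have e2 := h3 ((b - z) 0) (-(a - z) 0) (by
    ext i
    fin_cases i
    · simp; ring
    · simp only [cross] at hD
      simp at hD ⊢
      linarith)
  have e3 := h3 1 0 (by
    ext i
    fin_cases i
    · have := e2.2
      simp at this ⊢
      linarith
    · have := e1.2
      simp at this ⊢
      linarith)
  exact one_ne_zero e3.1

namespace RegularTriangulation

variable {Ω : Set Plane} (𝒯 : RegularTriangulation Ω)

lemma exists_isFrame {T : Finset Plane} (hT : T ∈ 𝒯.cells) {z : Plane} (hz : z ∈ T) :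
    ∃ a b, IsFrame T z a b := by
  classical
  have hc : (T.erase z).card = 2 := by rw [Finset.card_erase_of_mem hz, 𝒯.card_eq T hT]
  obtain ⟨a, b, hab, he⟩ := Finset.card_eq_two.1 hc
  have hT' : T = {z, a, b} := by rw [← Finset.insert_erase hz, he]
  have ha : a ∈ T.erase z := by rw [he]; simp
  have hb : b ∈ T.erase z := by rw [he]; simp
  have haz := (Finset.mem_erase.1 ha).1
  have hbz := (Finset.mem_erase.1 hb).1
  have hai := 𝒯.affineIndependent T hT
  have hinj : Function.Injective (![⟨z, hz⟩, ⟨a, Finset.mem_of_mem_erase ha⟩,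
      ⟨b, Finset.mem_of_mem_erase hb⟩] : Fin 3 → T) := by
    intro i j hij
    fin_cases i <;> fin_cases j <;> simp_all [Ne.symm]
  have h3 := hai.comp_embedding ⟨_, hinj⟩
  have h4 : AffineIndependent ℝ ![z, a, b] := by
    convert h3 using 1
    ext i j
    fin_cases i <;> rfl
  have h5 := cross_ne_zero_of_affineIndependent h4
  have hTs : (T : Set Plane) = {z, a, b} := by rw [hT']; simp
  rcases lt_or_gt_of_ne h5 with h | h
  · refine ⟨b, a, ?_, by rw [cross_comm]; linarith⟩
    rw [hTs, Set.pair_comm]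
  · exact ⟨a, b, hTs, h⟩

lemma hull_subset_closure {T : Finset Plane} (hT : T ∈ 𝒯.cells) : hull T ⊆ closure Ω := by
  rw [𝒯.closure_eq]
  exact Set.subset_biUnion_of_mem (u := fun T => hull T) hT

variable {𝒯}
variable {T T' : Finset Plane} {z a b x : Plane}

/-- Regularity enters here: `x` lies in the hull of the common vertices, and without `a` among them
its coordinate at `a` would be zero. -/
lemma snd_mem_of_baryA_pos (hT : T ∈ 𝒯.cells) (hT' : T' ∈ 𝒯.cells) (h : IsFrame T z a b)
    (hx : x ∈ hull T) (hx' : x ∈ hull T') (hpos : 0 < baryA z a b x) : a ∈ T' := by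
  by_contra ha
  have hx2 : x ∈ hull T ∩ hull T' := ⟨hx, hx'⟩
  rw [𝒯.inter_eq T hT T' hT'] at hx2
  have hsub : (T : Set Plane) ∩ T' ⊆ {z, b} := by
    rintro y ⟨hy, hy'⟩
    rcases h.mem_iff.1 hy with rfl | rfl | rfl
    · simp
    · exact absurd hy' ha
    · simp
  have hx3 := convexHull_mono (𝕜 := ℝ) hsub hx2
  rw [convexHull_pair, segment_eq_image'] at hx3
  obtain ⟨t, _, rfl⟩ := hx3
  have := baryA_add h.2.ne' 0 t
  rw [zero_smul, zero_add] at this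
  dsimp only at hpos
  rw [this] at hpos
  exact lt_irrefl _ hpos

lemma baryA_rotate (h : IsFrame T z a b) (x : Plane) : baryA a b z x = baryB z a b x := by
  conv_lhs => rw [eq_add_bary h.2.ne' x]
  set s := baryA z a b x
  set t := baryB z a b x
  have : z + (s • (a - z) + t • (b - z)) = a + (t • (b - a) + (1 - s - t) • (z - a)) := by module
  rw [this, baryA_add h.rotate.2.ne']

lemma baryB_rotate (h : IsFrame T z a b) (x : Plane) :
    baryB a b z x = 1 - baryA z a b x - baryB z a b x := by
  conv_lhs => rw [eq_add_bary h.2.ne' x]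
  set s := baryA z a b x
  set t := baryB z a b x
  have : z + (s • (a - z) + t • (b - z)) = a + (t • (b - a) + (1 - s - t) • (z - a)) := by module
  rw [this, baryB_add h.rotate.2.ne']

lemma thd_mem_of_baryB_pos (hT : T ∈ 𝒯.cells) (hT' : T' ∈ 𝒯.cells) (h : IsFrame T z a b)
    (hx : x ∈ hull T) (hx' : x ∈ hull T') (hpos : 0 < baryB z a b x) : b ∈ T' :=
  snd_mem_of_baryA_pos hT hT' h.rotate hx hx' (by rwa [baryA_rotate h])

lemma fst_mem_of_bary_lt (hT : T ∈ 𝒯.cells) (hT' : T' ∈ 𝒯.cells) (h : IsFrame T z a b)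
    (hx : x ∈ hull T) (hx' : x ∈ hull T') (hlt : baryA z a b x + baryB z a b x < 1) : z ∈ T' :=
  thd_mem_of_baryB_pos hT hT' h.rotate hx hx' (by rw [baryB_rotate h]; linarith)

lemma eq_of_subset (hT : T ∈ 𝒯.cells) (hT' : T' ∈ 𝒯.cells) (h : T ⊆ T') : T = T' :=
  Finset.eq_of_subset_of_card_le h (by rw [𝒯.card_eq T hT, 𝒯.card_eq T' hT'])

lemma eq_of_mem_hull (hT : T ∈ 𝒯.cells) (hT' : T' ∈ 𝒯.cells) (h : IsFrame T z a b)
    (hx' : x ∈ hull T') (hA : 0 < baryA z a b x) (hB : 0 < baryB z a b x)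
    (hAB : baryA z a b x + baryB z a b x < 1) : T = T' := by
  have hx : x ∈ hull T := (h.mem_hull_iff x).2 ⟨hA.le, hB.le, hAB.le⟩
  refine eq_of_subset hT hT' fun y hy => ?_
  rcases h.mem_iff.1 hy with rfl | rfl | rfl
  · exact fst_mem_of_bary_lt hT hT' h hx hx' hAB
  · exact snd_mem_of_baryA_pos hT hT' h hx hx' hA
  · exact thd_mem_of_baryB_pos hT hT' h hx hx' hB

/-- Both triangles lie on the same side of the line through `z` and `a`, so a point slightly off the
midpoint of that side is interior to both. -/
lemma eq_of_isFrame_snd (hT : T ∈ 𝒯.cells) (hT' : T' ∈ 𝒯.cells) {b' : Plane}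
    (h : IsFrame T z a b) (h' : IsFrame T' z a b') : T = T' := by
  set γ : ℝ → Plane := fun t => z + ((1 / 2 : ℝ) • (a - z) + t • (b - z)) with hγ
  have hγc : Continuous γ := by fun_prop
  have h0 : γ 0 = z + ((1 / 2 : ℝ) • (a - z) + (0 : ℝ) • (b' - z)) := by simp [hγ]
  have hA : 0 < baryA z a b' (γ 0) := by rw [h0, baryA_add h'.2.ne']; norm_num
  have hAB : baryA z a b' (γ 0) + baryB z a b' (γ 0) < 1 := by
    rw [h0, baryA_add h'.2.ne', baryB_add h'.2.ne']; norm_num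
  have ev : ∀ᶠ t in 𝓝[>] (0 : ℝ), 0 < baryA z a b' (γ t) ∧
      baryA z a b' (γ t) + baryB z a b' (γ t) < 1 ∧ t ∈ Set.Ioo (0 : ℝ) (1 / 2) := by
    refine Filter.Eventually.and ?_ (Filter.Eventually.and ?_ ?_)
    · exact nhdsWithin_le_nhds (((continuous_baryA z a b').comp hγc).continuousAt.eventually
        (lt_mem_nhds hA))
    · exact nhdsWithin_le_nhds ((((continuous_baryA z a b').add
        (continuous_baryB z a b')).comp hγc).continuousAt.eventually (gt_mem_nhds hAB))
    · exact Ioo_mem_nhdsGT (by norm_num)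
  obtain ⟨t, h1, h2, h3, h4⟩ := ev.exists
  have hB : 0 < baryB z a b' (γ t) := by
    rw [baryB]
    refine div_pos ?_ h'.2
    simp only [hγ, add_sub_cancel_left, cross_add_right, cross_smul_right, cross_self]
    have := mul_pos h3 h.2
    linarith
  refine eq_of_mem_hull (x := γ t) hT hT' h ?_ ?_ ?_ ?_
  · exact (h'.mem_hull_iff _).2 ⟨h1.le, hB.le, h2.le⟩
  · rw [hγ, baryA_add h.2.ne']; norm_num
  · rw [hγ, baryB_add h.2.ne']; exact h3
  · rw [hγ, baryA_add h.2.ne', baryB_add h.2.ne']; linarith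

lemma eq_of_isFrame_thd (hT : T ∈ 𝒯.cells) (hT' : T' ∈ 𝒯.cells) {a' : Plane}
    (h : IsFrame T z a b) (h' : IsFrame T' z a' b) : T = T' :=
  eq_of_isFrame_snd hT hT' h.rotate.rotate h'.rotate.rotate

lemma exists_isFrame_next (hT : T ∈ 𝒯.cells) (hT' : T' ∈ 𝒯.cells) (h : IsFrame T z a b)
    (hne : T' ≠ T) (hz : z ∈ T') (hb : b ∈ T') : ∃ c, IsFrame T' z b c := by
  obtain ⟨p, q, hpq⟩ := 𝒯.exists_isFrame hT' hz
  rcases hpq.mem_iff.1 hb with hb | rfl | rfl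
  · exact absurd hb h.thd_ne
  · exact ⟨q, hpq⟩
  · exact absurd (eq_of_isFrame_thd hT' hT hpq h) hne

lemma exists_isFrame_prev (hT : T ∈ 𝒯.cells) (hT' : T' ∈ 𝒯.cells) (h : IsFrame T z a b)
    (hne : T' ≠ T) (hz : z ∈ T') (ha : a ∈ T') : ∃ c, IsFrame T' z c a := by
  obtain ⟨p, q, hpq⟩ := 𝒯.exists_isFrame hT' hz
  rcases hpq.mem_iff.1 ha with ha | rfl | rfl
  · exact absurd ha h.snd_ne
  · exact absurd (eq_of_isFrame_snd hT' hT hpq h) hne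
  · exact ⟨p, hpq⟩

/-- The two triangles lie on opposite sides of the line through `z` and `b`, so together they fill a
neighbourhood of the point inside `closure Ω`. -/
lemma mem_of_shared_side (hΩ : interior (closure Ω) = Ω) (hT : T ∈ 𝒯.cells)
    (hT' : T' ∈ 𝒯.cells) {c : Plane} (h : IsFrame T z a b) (h' : IsFrame T' z b c) {t : ℝ}
    (ht0 : 0 < t) (ht1 : t < 1) : z + t • (b - z) ∈ Ω := by
  set x := z + t • (b - z) with hx
  have hx1 : x = z + ((0 : ℝ) • (a - z) + t • (b - z)) := by simp [hx]
  have hx2 : x = z + (t • (b - z) + (0 : ℝ) • (c - z)) := by simp [hx]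
  have h1 : 0 < baryB z a b x := by rw [hx1, baryB_add h.2.ne']; exact ht0
  have h2 : baryA z a b x + baryB z a b x < 1 := by
    rw [hx1, baryB_add h.2.ne', baryA_add h.2.ne']; linarith
  have h3 : 0 < baryA z b c x := by rw [hx2, baryA_add h'.2.ne']; exact ht0
  have h4 : baryA z b c x + baryB z b c x < 1 := by
    rw [hx2, baryB_add h'.2.ne', baryA_add h'.2.ne']; linarith
  rw [← hΩ, mem_interior_iff_mem_nhds]
  filter_upwards [(continuous_baryB z a b).continuousAt.eventually (lt_mem_nhds h1),
    ((continuous_baryA z a b).add (continuous_baryB z a b)).continuousAt.eventually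
      (gt_mem_nhds h2),
    (continuous_baryA z b c).continuousAt.eventually (lt_mem_nhds h3),
    ((continuous_baryA z b c).add (continuous_baryB z b c)).continuousAt.eventually
      (gt_mem_nhds h4)] with y e1 e2 e3 e4
  rcases le_total 0 (cross (y - z) (b - z)) with hc | hc
  · exact 𝒯.hull_subset_closure hT
      ((h.mem_hull_iff y).2 ⟨div_nonneg hc h.2.le, e1.le, e2.le⟩)
  · refine 𝒯.hull_subset_closure hT'
      ((h'.mem_hull_iff y).2 ⟨e3.le, div_nonneg ?_ h'.2.le, e4.le⟩)
    rw [cross_comm]; linarith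

lemma isOpen_of_interior_closure (hΩ : interior (closure Ω) = Ω) : IsOpen Ω := by
  rw [← hΩ]; exact isOpen_interior

/-- If the point were in `Ω`, one could leave `T` across the side and stay in `Ω`. By finiteness and
closedness, a triangle covering nearby points outside contains the point itself, hence both ends of
the side, so it is `T`. -/
lemma notMem_of_unshared_side (hΩ : interior (closure Ω) = Ω) (hT : T ∈ 𝒯.cells)
    (h : IsFrame T z a b) (hu : ∀ T' ∈ 𝒯.cells, z ∈ T' → b ∈ T' → T' = T) {t : ℝ}
    (ht0 : 0 < t) (ht1 : t < 1) : z + t • (b - z) ∉ Ω := by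
  set x := z + t • (b - z) with hx
  intro hxΩ
  have hx1 : x = z + ((0 : ℝ) • (a - z) + t • (b - z)) := by simp [hx]
  have h0 : baryA z a b x = 0 := by rw [hx1, baryA_add h.2.ne']
  have h1 : baryB z a b x = t := by rw [hx1, baryB_add h.2.ne']
  have hxT : x ∈ hull T := (h.mem_hull_iff x).2 ⟨by rw [h0], by rw [h1]; exact ht0.le,
    by rw [h0, h1]; linarith⟩
  have ev : ∀ᶠ y in 𝓝 x, y ∈ Ω ∧ ∀ T' ∈ 𝒯.cells, x ∉ hull T' → y ∉ hull T' := by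
    refine ((isOpen_of_interior_closure hΩ).eventually_mem hxΩ).and ?_
    rw [Finset.eventually_all]
    intro T' _
    by_cases hxT' : x ∈ hull T'
    · exact Filter.Eventually.of_forall fun _ h => absurd hxT' h
    · filter_upwards [(isClosed_hull T').isOpen_compl.eventually_mem hxT'] with y hy _ using hy
  set γ : ℝ → Plane := fun s => z + (s • (a - z) + t • (b - z)) with hγ
  have hγc : Continuous γ := by fun_prop
  have hγ0 : γ 0 = x := by rw [hγ, hx1]
  have ev2 : ∀ᶠ s in 𝓝[<] (0 : ℝ), (γ s ∈ Ω ∧ ∀ T' ∈ 𝒯.cells, x ∉ hull T' → γ s ∉ hull T') ∧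
      s < 0 := by
    refine Filter.Eventually.and ?_ self_mem_nhdsWithin
    have ht : Tendsto γ (𝓝 0) (𝓝 x) := by rw [← hγ0]; exact hγc.tendsto 0
    exact nhdsWithin_le_nhds (ht.eventually ev)
  obtain ⟨s, ⟨hs1, hs2⟩, hs3⟩ := ev2.exists
  have hs4 : γ s ∈ closure Ω := subset_closure hs1
  rw [𝒯.closure_eq] at hs4
  simp only [Set.mem_iUnion] at hs4
  obtain ⟨T', hT', hs5⟩ := hs4
  have hxT' : x ∈ hull T' := by
    by_contra hc
    exact hs2 T' hT' hc hs5
  have hzT' : z ∈ T' := fst_mem_of_bary_lt hT hT' h hxT hxT' (by rw [h0, h1]; linarith)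
  have hbT' : b ∈ T' := thd_mem_of_baryB_pos hT hT' h hxT hxT' (by rw [h1]; exact ht0)
  rw [hu T' hT' hzT' hbT', h.mem_hull_iff, hγ, baryA_add h.2.ne'] at hs5
  linarith [hs5.1]

lemma frontier_eq (hΩ : interior (closure Ω) = Ω) : frontier Ω = closure Ω \ Ω :=
  (isOpen_of_interior_closure hΩ).frontier_eq

lemma segment_subset_frontier (hΩ : interior (closure Ω) = Ω) (hT : T ∈ 𝒯.cells)
    (h : IsFrame T z a b) (hu : ∀ T' ∈ 𝒯.cells, z ∈ T' → b ∈ T' → T' = T) :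
    segment ℝ z b ⊆ frontier Ω := by
  have h1 : openSegment ℝ z b ⊆ frontier Ω := by
    intro x hx
    rw [openSegment_eq_image'] at hx
    obtain ⟨t, ht, rfl⟩ := hx
    rw [frontier_eq hΩ]
    refine ⟨𝒯.hull_subset_closure hT ?_, notMem_of_unshared_side hΩ hT h hu ht.1 ht.2⟩
    exact (convex_hull T).segment_subset (subset_hull h.fst_mem) (subset_hull h.thd_mem)
      (by rw [segment_eq_image']; exact ⟨t, ⟨ht.1.le, ht.2.le⟩, rfl⟩)
  rw [← closure_openSegment]
  exact closure_minimal h1 isClosed_frontier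

lemma segment_not_subset_frontier (hΩ : interior (closure Ω) = Ω) (hT : T ∈ 𝒯.cells)
    (hT' : T' ∈ 𝒯.cells) {c : Plane} (h : IsFrame T z a b) (h' : IsFrame T' z b c) :
    ¬ segment ℝ z b ⊆ frontier Ω := by
  intro hs
  have h1 : z + (1 / 2 : ℝ) • (b - z) ∈ frontier Ω :=
    hs (by rw [segment_eq_image']; exact ⟨1 / 2, by norm_num, rfl⟩)
  rw [frontier_eq hΩ] at h1
  exact h1.2 (mem_of_shared_side hΩ hT hT' h h' (by norm_num) (by norm_num))

end RegularTriangulation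

end Frames

/-! ### A closed fan covers the plane by its cones. -/

section FanGeometry

variable {C : Type*} [Finite C] {z : Plane} {f l : C → Plane}

lemma baryA_pos_or_baryB_pos {a b x : Plane} (hx : x ≠ z) (hD : 0 < cross (a - z) (b - z))
    (hA : 0 ≤ baryA z a b x) (hB : 0 ≤ baryB z a b x) :
    0 < baryA z a b x ∨ 0 < baryB z a b x := by
  by_contra hcon
  push Not at hcon
  have h1 := eq_add_bary hD.ne' x
  rw [le_antisymm hcon.1 hA, le_antisymm hcon.2 hB] at h1
  simp only [zero_smul, add_zero] at h1
  exact hx h1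

/-- The cones of a closed fan cover the plane. -/
lemma IsClosedFan.exists_bary_nonneg (hD : ∀ T, 0 < cross (f T - z) (l T - z)) {O : Set C}
    (hne : O.Nonempty) (hO : IsClosedFan f l O) (x : Plane) :
    ∃ T ∈ O, 0 ≤ baryA z (f T) (l T) x ∧ 0 ≤ baryB z (f T) (l T) x := by
  set K : Set Plane := {x | ∃ T ∈ O, 0 ≤ baryA z (f T) (l T) x ∧ 0 ≤ baryB z (f T) (l T) x}
    with hK
  have hKclosed : IsClosed K := by
    have : K = ⋃ T ∈ O, {x | 0 ≤ baryA z (f T) (l T) x ∧ 0 ≤ baryB z (f T) (l T) x} := by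
      ext y; simp [hK, and_left_comm]
    rw [this]
    refine Set.Finite.isClosed_biUnion (Set.toFinite O) fun T _ => ?_
    exact (isClosed_le continuous_const (continuous_baryA _ _ _)).inter
      (isClosed_le continuous_const (continuous_baryB _ _ _))
  -- A point other than `z` is interior to a cone or lies on a ray shared with the neighbouring
  -- cone, which exists because the fan is closed.
  have hKnhds : ∀ y ∈ K, y ≠ z → K ∈ 𝓝 y := by
    rintro y ⟨T, hT, hA, hB⟩ hy
    rcases hA.lt_or_eq with hA' | hA'
    · rcases hB.lt_or_eq with hB' | hB'
      · filter_upwards [(continuous_baryA z (f T) (l T)).continuousAt.eventually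
          (lt_mem_nhds hA'), (continuous_baryB z (f T) (l T)).continuousAt.eventually
          (lt_mem_nhds hB')] with w h1 h2 using ⟨T, hT, h1.le, h2.le⟩
      · obtain ⟨T', hT', hl⟩ := (hO T hT).2
        have hyl : y = z + baryA z (f T) (l T) y • (f T - z) := by
          have := eq_add_bary (hD T).ne' y
          rw [← hB'] at this
          simpa using this
        have hB2 : 0 < baryB z (f T') (l T') y := by
          have h1 : y = z + ((0 : ℝ) • (f T' - z) + baryA z (f T) (l T) y • (l T' - z)) := by
            rw [hl, zero_smul, zero_add]; exact hyl
          rw [h1, baryB_add (hD T').ne']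
          exact hA'
        filter_upwards [(continuous_baryA z (f T) (l T)).continuousAt.eventually
          (lt_mem_nhds hA'), (continuous_baryB z (f T') (l T')).continuousAt.eventually
          (lt_mem_nhds hB2)] with w h1 h2
        rcases le_total 0 (cross (f T - z) (w - z)) with hc | hc
        · exact ⟨T, hT, h1.le, div_nonneg hc (hD T).le⟩
        · refine ⟨T', hT', div_nonneg ?_ (hD T').le, h2.le⟩
          rw [hl, cross_comm]; linarith
    · have hB' := (baryA_pos_or_baryB_pos hy (hD T) hA hB).resolve_left (by rw [← hA']; exact lt_irrefl _)
      obtain ⟨T', hT', hf⟩ := (hO T hT).1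
      have hyl : y = z + baryB z (f T) (l T) y • (l T - z) := by
        have := eq_add_bary (hD T).ne' y
        rw [← hA'] at this
        simpa using this
      have hA2 : 0 < baryA z (f T') (l T') y := by
        have h1 : y = z + (baryB z (f T) (l T) y • (f T' - z) + (0 : ℝ) • (l T' - z)) := by
          rw [hf, zero_smul, add_zero]; exact hyl
        rw [h1, baryA_add (hD T').ne']
        exact hB'
      filter_upwards [(continuous_baryB z (f T) (l T)).continuousAt.eventually
        (lt_mem_nhds hB'), (continuous_baryA z (f T') (l T')).continuousAt.eventually
        (lt_mem_nhds hA2)] with w h1 h2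
      rcases le_total 0 (cross (w - z) (l T - z)) with hc | hc
      · exact ⟨T, hT, div_nonneg hc (hD T).le, h1.le⟩
      · refine ⟨T', hT', h2.le, div_nonneg ?_ (hD T').le⟩
        rw [hf, cross_comm]; linarith
  have hzK : z ∈ K := by
    obtain ⟨T, hT⟩ := hne
    exact ⟨T, hT, by simp [baryA, cross_zero_left], by simp [baryB, cross_zero_right]⟩
  -- Off `z`, the set `K` is open and closed in the punctured plane, which is connected.
  have hconn : IsPreconnected ({z}ᶜ : Set Plane) := by
    refine (isConnected_compl_singleton_of_one_lt_rank ?_ z).isPreconnected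
    rw [← Module.finrank_eq_rank]
    simp
  by_contra hx
  have hxK : x ∉ K := hx
  obtain ⟨T, hT⟩ := hne
  have hfz : f T ≠ z := by
    intro h
    have := hD T
    rw [h, sub_self, cross_zero_left] at this
    exact lt_irrefl _ this
  have hfK : f T ∈ K := by
    refine ⟨T, hT, ?_, ?_⟩
    · rw [baryA, div_self (hD T).ne']; exact zero_le_one
    · rw [baryB, cross_self, zero_div]
  obtain ⟨y, -, hy1, hy2⟩ := hconn (interior K) Kᶜ isOpen_interior hKclosed.isOpen_compl
    (by
      intro y hy
      by_cases hyK : y ∈ K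
      · exact Or.inl (mem_interior_iff_mem_nhds.2 (hKnhds y hyK hy))
      · exact Or.inr hyK)
    ⟨f T, hfz, mem_interior_iff_mem_nhds.2 (hKnhds _ hfK hfz)⟩
    ⟨x, fun h => hxK (by rw [Set.mem_singleton_iff.1 h]; exact hzK), hxK⟩
  exact hy2 (interior_subset hy1)

end FanGeometry

/-! ### The star of a node and the estimate at one node. -/

namespace RegularTriangulation

variable {Ω : Set Plane} {𝒯 : RegularTriangulation Ω} {z : Plane}

lemma mem_cellsAt {T : Finset Plane} : T ∈ 𝒯.cellsAt z ↔ T ∈ 𝒯.cells ∧ z ∈ T := by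
  simp [cellsAt]

variable (𝒯 z) in
/-- The triangles at the node `z` as a type. -/
abbrev Star : Type := {T : Finset Plane // T ∈ 𝒯.cellsAt z}

lemma Star.mem_cells (T : 𝒯.Star z) : T.1 ∈ 𝒯.cells := (mem_cellsAt.1 T.2).1

lemma Star.mem (T : 𝒯.Star z) : z ∈ T.1 := (mem_cellsAt.1 T.2).2

variable (𝒯 z) in
lemma exists_star_frames : ∃ f l : 𝒯.Star z → Plane, ∀ T, IsFrame T.1 z (f T) (l T) := by
  choose f l h using fun T : 𝒯.Star z => 𝒯.exists_isFrame T.mem_cells T.mem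
  exact ⟨f, l, h⟩

section

variable {f l : 𝒯.Star z → Plane} (hfl : ∀ T, IsFrame T.1 z (f T) (l T))
include hfl

lemma star_fst_injective : Function.Injective f := by
  intro T T' h
  have h1 := hfl T
  rw [h] at h1
  exact Subtype.ext (eq_of_isFrame_snd T.mem_cells T'.mem_cells h1 (hfl T'))

lemma star_lst_injective : Function.Injective l := by
  intro T T' h
  have h1 := hfl T
  rw [h] at h1
  exact Subtype.ext (eq_of_isFrame_thd T.mem_cells T'.mem_cells h1 (hfl T'))

/-- Close to `z` a triangle coincides with its cone, and the cones of a closed fan cover the plane.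
-/
lemma eventually_exists_mem_hull {O : Set (𝒯.Star z)} (hne : O.Nonempty)
    (hO : IsClosedFan f l O) : ∀ᶠ x in 𝓝 z, ∃ T ∈ O, x ∈ hull T.1 := by
  have ev : ∀ᶠ x in 𝓝 z, ∀ T, baryA z (f T) (l T) x + baryB z (f T) (l T) x < 1 := by
    rw [Filter.eventually_all]
    intro T
    refine ((continuous_baryA _ _ _).add (continuous_baryB _ _ _)).continuousAt.eventually
      (gt_mem_nhds ?_)
    simp [baryA, baryB, cross_zero_left, cross_zero_right]
  filter_upwards [ev] with x hx
  obtain ⟨T, hT, h1, h2⟩ := hO.exists_bary_nonneg (fun T => (hfl T).2) hne x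
  exact ⟨T, hT, ((hfl T).mem_hull_iff x).2 ⟨h1, h2, (hx T).le⟩⟩

lemma mem_of_isClosedFan (hΩ : interior (closure Ω) = Ω) {O : Set (𝒯.Star z)}
    (hne : O.Nonempty) (hO : IsClosedFan f l O) : z ∈ Ω := by
  rw [← hΩ, mem_interior_iff_mem_nhds]
  filter_upwards [eventually_exists_mem_hull hfl hne hO] with x hx
  obtain ⟨T, _, hT⟩ := hx
  exact 𝒯.hull_subset_closure T.mem_cells hT

/-- Interior points of any triangle of the star, taken close to `z`, are already covered by the fan,
and an interior point belongs to one triangle only. -/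
lemma eq_univ_of_isClosedFan {O : Set (𝒯.Star z)}
    (hne : O.Nonempty) (hO : IsClosedFan f l O) : O = Set.univ := by
  refine Set.eq_univ_of_forall fun T => ?_
  set γ : ℝ → Plane := fun t => z + (t • (f T - z) + t • (l T - z)) with hγ
  have ht : Tendsto γ (𝓝 0) (𝓝 z) := by
    have h0 : γ 0 = z := by simp [hγ]
    have : Continuous γ := by fun_prop
    conv_rhs => rw [← h0]
    exact this.tendsto 0
  have ev : ∀ᶠ t in 𝓝[>] (0 : ℝ), (∃ T ∈ O, γ t ∈ hull T.1) ∧ t ∈ Set.Ioo (0 : ℝ) (1 / 2) :=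
    Filter.Eventually.and
      (nhdsWithin_le_nhds (ht.eventually (eventually_exists_mem_hull hfl hne hO)))
      (Ioo_mem_nhdsGT (by norm_num))
  obtain ⟨t, ⟨T', hT', hx⟩, ht0, ht1⟩ := ev.exists
  have := eq_of_mem_hull T.mem_cells T'.mem_cells (hfl T) hx
    (by rw [hγ, baryA_add (hfl T).2.ne']; exact ht0)
    (by rw [hγ, baryB_add (hfl T).2.ne']; exact ht0)
    (by rw [hγ, baryA_add (hfl T).2.ne', baryB_add (hfl T).2.ne']; linarith)
  rwa [Subtype.ext this]

lemma star_next_iff (T : 𝒯.Star z) :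
    (∃ T', f T' = l T) ↔ ∃ T' ∈ 𝒯.cells, z ∈ T' ∧ l T ∈ T' ∧ T' ≠ T.1 := by
  constructor
  · rintro ⟨T', h⟩
    refine ⟨T'.1, T'.mem_cells, T'.mem, h ▸ (hfl T').snd_mem, ?_⟩
    intro he
    have : T' = T := Subtype.ext he
    rw [this] at h
    exact (hfl T).thd_ne_snd h.symm
  · rintro ⟨T', h1, h2, h3, h4⟩
    obtain ⟨c, hc⟩ := exists_isFrame_next T.mem_cells h1 (hfl T) h4 h2 h3
    exact ⟨⟨T', mem_cellsAt.2 ⟨h1, h2⟩⟩, ((hfl ⟨T', mem_cellsAt.2 ⟨h1, h2⟩⟩).unique hc).1.symm⟩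

lemma star_prev_iff (T : 𝒯.Star z) :
    (∃ T', l T' = f T) ↔ ∃ T' ∈ 𝒯.cells, z ∈ T' ∧ f T ∈ T' ∧ T' ≠ T.1 := by
  constructor
  · rintro ⟨T', h⟩
    refine ⟨T'.1, T'.mem_cells, T'.mem, h ▸ (hfl T').thd_mem, ?_⟩
    intro he
    have : T' = T := Subtype.ext he
    rw [this] at h
    exact (hfl T).thd_ne_snd h
  · rintro ⟨T', h1, h2, h3, h4⟩
    obtain ⟨c, hc⟩ := exists_isFrame_prev T.mem_cells h1 (hfl T) h4 h2 h3
    exact ⟨⟨T', mem_cellsAt.2 ⟨h1, h2⟩⟩, ((hfl ⟨T', mem_cellsAt.2 ⟨h1, h2⟩⟩).unique hc).2.symm⟩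

lemma star_segment_lst (hΩ : interior (closure Ω) = Ω) (T : 𝒯.Star z)
    (h : ¬ ∃ T', f T' = l T) : segment ℝ z (l T) ⊆ frontier Ω := by
  refine segment_subset_frontier hΩ T.mem_cells (hfl T) fun T' h1 h2 h3 => ?_
  by_contra h4
  exact h ((star_next_iff hfl T).2 ⟨T', h1, h2, h3, h4⟩)

lemma star_segment_fst (hΩ : interior (closure Ω) = Ω) (T : 𝒯.Star z)
    (h : ¬ ∃ T', l T' = f T) : segment ℝ z (f T) ⊆ frontier Ω := by
  rw [segment_symm]
  refine segment_subset_frontier hΩ T.mem_cells (hfl T).rotate fun T' h1 h2 h3 => ?_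
  by_contra h4
  exact h ((star_prev_iff hfl T).2 ⟨T', h1, h3, h2, h4⟩)

end

lemma affineMap_midpoint (p : Plane →ᵃ[ℝ] ℝ) (z b : Plane) :
    p (midpoint ℝ z b) = p z + p.linear (b - z) / 2 := by
  have h : p b = p.linear (b - z) + p z := by simpa using p.map_vadd z (b - z)
  rw [p.map_midpoint, midpoint_eq_smul_add, h]
  simp only [invOf_eq_inv, smul_eq_mul]
  ring

/-- The estimate of the nodal averaging at one node. -/
lemma node_estimate (hΩ : interior (closure Ω) = Ω) {v : Plane → ℝ} (hv : 𝒯.MemCR10 v)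
    (hz : z ∈ 𝒯.nodes) :
    4 * 𝒯.eigenvalueFactor * ∑ T ∈ 𝒯.cellsAt z, (piece v T z - 𝒯.nodalAverage v z) ^ 2
      ≤ ∑ T ∈ 𝒯.cellsAt z, ∑ a ∈ T, ((piece v T).linear (a - z)) ^ 2 := by
  obtain ⟨f, l, hfl⟩ := 𝒯.exists_star_frames z
  have hcard : Fintype.card (𝒯.Star z) = (𝒯.cellsAt z).card := Fintype.card_coe _
  have hzcl : z ∈ closure Ω := by
    classical
    obtain ⟨T, hT, hzT⟩ := Finset.mem_biUnion.1 hz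
    exact 𝒯.hull_subset_closure hT (subset_hull hzT)
  set x : 𝒯.Star z → ℝ := fun T => piece v T.1 z - 𝒯.nodalAverage v z with hx
  set qf : 𝒯.Star z → ℝ := fun T => ((piece v T.1).linear (f T - z)) ^ 2 with hqf
  set ql : 𝒯.Star z → ℝ := fun T => ((piece v T.1).linear (l T - z)) ^ 2 with hql
  -- Equality at the midpoint gives the jump `(s - t) / 2` in terms of the two increments `s` and
  -- `t`, and `(s - t)² / 4 ≤ (s² + t²) / 2`.
  have hjump : ∀ T T', f T' = l T → (x T' - x T) ^ 2 ≤ (ql T + qf T') / 2 := by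
    intro T T' h
    have hT' := hfl T'
    rw [h] at hT'
    have hm := hv.2.1 z (l T) (hfl T).thd_ne.symm
      (segment_not_subset_frontier hΩ T.mem_cells T'.mem_cells (hfl T) hT')
      T.1 T.mem_cells T'.1 T'.mem_cells T.mem (hfl T).thd_mem T'.mem hT'.snd_mem
    rw [affineMap_midpoint, affineMap_midpoint] at hm
    simp only [hx, hql, hqf, h]
    have e : piece v T'.1 z - 𝒯.nodalAverage v z - (piece v T.1 z - 𝒯.nodalAverage v z)
        = ((piece v T.1).linear (l T - z) - (piece v T'.1).linear (l T - z)) / 2 := by linarith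
    rw [e]
    nlinarith [sq_nonneg ((piece v T.1).linear (l T - z) + (piece v T'.1).linear (l T - z))]
  have hlhs : ∑ T ∈ 𝒯.cellsAt z, (piece v T z - 𝒯.nodalAverage v z) ^ 2 = ∑ T, x T ^ 2 :=
    (Finset.sum_coe_sort _ fun T => (piece v T z - 𝒯.nodalAverage v z) ^ 2).symm
  have hrhs : ∑ T ∈ 𝒯.cellsAt z, ∑ a ∈ T, ((piece v T).linear (a - z)) ^ 2
      = ∑ T, (qf T + ql T) := by
    rw [← Finset.sum_coe_sort]
    refine Finset.sum_congr rfl fun T _ => ?_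
    rw [(hfl T).sum_eq fun a => ((piece v T.1).linear (a - z)) ^ 2]
    simp [hqf, hql]
  rw [hlhs, hrhs]
  have hxnn : 0 ≤ ∑ T, x T ^ 2 := Finset.sum_nonneg fun _ _ => sq_nonneg _
  by_cases hzΩ : z ∈ Ω
  · have hzint : z ∈ 𝒯.interiorNodes := by simp [interiorNodes, hz, hzΩ]
    have hnext : ∀ T, ∃ T', f T' = l T := by
      intro T
      by_contra h
      have := star_segment_lst hfl hΩ T h (left_mem_segment ℝ _ _)
      rw [frontier_eq hΩ] at this
      exact this.2 hzΩ
    have hsum : ∑ T, x T = 0 := by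
      simp only [hx, Finset.sum_sub_distrib, Finset.sum_const, Finset.card_univ, hcard,
        nsmul_eq_mul]
      rw [Finset.sum_coe_sort _ fun T => piece v T z, nodalAverage, if_pos hzint]
      have hpos : (0 : ℝ) < (𝒯.cellsAt z).card := by
        classical
        obtain ⟨T, hT, hzT⟩ := Finset.mem_biUnion.1 hz
        exact_mod_cast Finset.card_pos.2 ⟨T, mem_cellsAt.2 ⟨hT, hzT⟩⟩
      field_simp
      ring
    have hM : (𝒯.cellsAt z).card ≤ 𝒯.Mint :=
      Finset.le_sup (f := fun z => (𝒯.cellsAt z).card) hzint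
    have := fan_estimate_cycle (star_lst_injective hfl) hnext
      (fun O h1 h2 => eq_univ_of_isClosedFan hfl h1 h2) hsum hjump (hcard.le.trans hM)
    refine le_trans ?_ this
    have hle : 𝒯.eigenvalueFactor ≤ 1 - Real.cos (2 * Real.pi / 𝒯.Mint) := by
      rw [eigenvalueFactor, if_pos ⟨z, hzint⟩]
      exact min_le_left _ _
    gcongr
  · have hzf : z ∈ frontier Ω := by rw [frontier_eq hΩ]; exact ⟨hzcl, hzΩ⟩
    have hzbd : z ∈ 𝒯.boundaryNodes := by simp [boundaryNodes, hz, hzf]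
    have hav : 𝒯.nodalAverage v z = 0 := by
      rw [nodalAverage, if_neg]
      simp [interiorNodes, hzΩ]
    have hM : (𝒯.cellsAt z).card ≤ 𝒯.Mbd :=
      Finset.le_sup (f := fun z => (𝒯.cellsAt z).card) hzbd
    -- At an end of a path the side is a boundary side, so `v|_T` vanishes at its midpoint, and its
    -- value at `z` is minus half the increment.
    have := fan_estimate_path (star_fst_injective hfl) (star_lst_injective hfl)
      (fun O h1 h2 => hzΩ (mem_of_isClosedFan hfl hΩ h1 h2)) hjump
      (by
        intro T h
        have := hv.2.2 z (l T) (hfl T).thd_ne.symm (star_segment_lst hfl hΩ T h) T.1 T.mem_cells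
          T.mem (hfl T).thd_mem
        rw [affineMap_midpoint] at this
        simp only [hx, hql, hav, sub_zero]
        rw [show piece v T.1 z = - ((piece v T.1).linear (l T - z) / 2) by linarith]
        exact le_of_eq (by ring))
      (by
        intro T h
        have := hv.2.2 z (f T) (hfl T).snd_ne.symm (star_segment_fst hfl hΩ T h) T.1 T.mem_cells
          T.mem (hfl T).snd_mem
        rw [affineMap_midpoint] at this
        simp only [hx, hqf, hav, sub_zero]
        rw [show piece v T.1 z = - ((piece v T.1).linear (f T - z) / 2) by linarith]
        exact le_of_eq (by ring))
      (hcard.le.trans hM)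
    refine le_trans ?_ this
    have hle : 𝒯.eigenvalueFactor ≤ 1 - Real.cos (Real.pi / 𝒯.Mbd) := by
      rw [eigenvalueFactor]
      split_ifs
      · exact min_le_right _ _
      · exact le_rfl
    gcongr

/-- A node with the largest first coordinate: `closure Ω` lies in a half plane bounded by a line
through it. This excludes `Mbd = 0`, for which the factor would be `1 - cos 0 = 0`. -/
lemma exists_boundaryNode (hΩ : interior (closure Ω) = Ω) (hne : 𝒯.cells.Nonempty) :
    ∃ z, z ∈ 𝒯.boundaryNodes := by
  classical
  obtain ⟨T₀, hT₀⟩ := hne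
  obtain ⟨z₀, hz₀⟩ : T₀.Nonempty := by
    rw [← Finset.card_pos, 𝒯.card_eq T₀ hT₀]; norm_num
  have hnode : ∀ {T z}, T ∈ 𝒯.cells → z ∈ T → z ∈ 𝒯.nodes :=
    fun hT hz => Finset.mem_biUnion.2 ⟨_, hT, hz⟩
  obtain ⟨z, hz, hmax⟩ := Finset.exists_max_image 𝒯.nodes (fun z => z 0) ⟨z₀, hnode hT₀ hz₀⟩
  refine ⟨z, ?_⟩
  have hsub : closure Ω ⊆ {x : Plane | x 0 ≤ z 0} := by
    rw [𝒯.closure_eq]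
    refine Set.iUnion₂_subset fun T hT => ?_
    refine convexHull_min (fun y hy => hmax y (hnode hT hy)) ?_
    exact convex_halfSpace_le (f := fun x : Plane => x 0) ⟨fun _ _ => rfl, fun _ _ => rfl⟩ _
  have hzΩ : z ∉ Ω := by
    intro h
    set γ : ℝ → Plane := fun t => z + t • EuclideanSpace.single (0 : Fin 2) (1 : ℝ) with hγ
    have ht : Tendsto γ (𝓝 0) (𝓝 z) := by
      have h0 : γ 0 = z := by simp [hγ]
      have : Continuous γ := by fun_prop
      conv_rhs => rw [← h0]
      exact this.tendsto 0
    have ev : ∀ᶠ t in 𝓝[>] (0 : ℝ), γ t ∈ Ω ∧ 0 < t :=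
      Filter.Eventually.and (nhdsWithin_le_nhds (ht.eventually
        ((isOpen_of_interior_closure hΩ).eventually_mem h))) self_mem_nhdsWithin
    obtain ⟨t, h1, h2⟩ := ev.exists
    have h3 := hsub (subset_closure h1)
    simp [hγ] at h3
    linarith
  have hzcl : z ∈ closure Ω := by
    obtain ⟨T, hT, hzT⟩ := Finset.mem_biUnion.1 hz
    exact 𝒯.hull_subset_closure hT (subset_hull hzT)
  have hzf : z ∈ frontier Ω := by rw [frontier_eq hΩ]; exact ⟨hzcl, hzΩ⟩
  simp [boundaryNodes, hz, hzf]

lemma one_sub_cos_pos {θ : ℝ} (h0 : 0 < θ) (h1 : θ ≤ Real.pi) : 0 < 1 - Real.cos θ := by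
  have := Real.cos_lt_cos_of_nonneg_of_le_pi le_rfl h1 h0
  rw [Real.cos_zero] at this
  linarith

/-- Needed for `2π / Mint ≤ π`. A triangle without a next one would have a boundary side at `z`. -/
lemma two_le_card_cellsAt (hΩ : interior (closure Ω) = Ω) (hz : z ∈ 𝒯.interiorNodes) :
    2 ≤ (𝒯.cellsAt z).card := by
  classical
  obtain ⟨hz, hzΩ⟩ := Finset.mem_filter.1 hz
  obtain ⟨T, hT, hzT⟩ := Finset.mem_biUnion.1 hz
  obtain ⟨f, l, hfl⟩ := 𝒯.exists_star_frames z
  have hTz : T ∈ 𝒯.cellsAt z := mem_cellsAt.2 ⟨hT, hzT⟩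
  by_cases h : ∃ T', f T' = l ⟨T, hTz⟩
  · obtain ⟨T', h1, h2, _, h4⟩ := (star_next_iff hfl ⟨T, hTz⟩).1 h
    exact Finset.one_lt_card.2 ⟨T', mem_cellsAt.2 ⟨h1, h2⟩, T, hTz, h4⟩
  · have := star_segment_lst hfl hΩ _ h (left_mem_segment ℝ _ _)
    rw [frontier_eq hΩ] at this
    exact absurd hzΩ this.2

lemma eigenvalueFactor_pos (hΩ : interior (closure Ω) = Ω) (hne : 𝒯.cells.Nonempty) :
    0 < 𝒯.eigenvalueFactor := by
  have hπ := Real.pi_pos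
  have h1 : 0 < 1 - Real.cos (Real.pi / 𝒯.Mbd) := by
    obtain ⟨z, hz⟩ := exists_boundaryNode hΩ hne
    have hM : (𝒯.cellsAt z).card ≤ 𝒯.Mbd :=
      Finset.le_sup (f := fun z => (𝒯.cellsAt z).card) hz
    have hpos : 0 < (𝒯.cellsAt z).card := by
      classical
      obtain ⟨T, hT, hzT⟩ := Finset.mem_biUnion.1 (Finset.mem_filter.1 hz).1
      exact Finset.card_pos.2 ⟨T, mem_cellsAt.2 ⟨hT, hzT⟩⟩
    have h1M : (1 : ℝ) ≤ 𝒯.Mbd := by exact_mod_cast hpos.trans_le hM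
    exact one_sub_cos_pos (by positivity) (div_le_self hπ.le h1M)
  rw [eigenvalueFactor]
  split_ifs with h
  · refine lt_min ?_ h1
    obtain ⟨z, hz⟩ := h
    have hM : (𝒯.cellsAt z).card ≤ 𝒯.Mint :=
      Finset.le_sup (f := fun z => (𝒯.cellsAt z).card) hz
    have h2M : (2 : ℝ) ≤ 𝒯.Mint := by exact_mod_cast (two_le_card_cellsAt hΩ hz).trans hM
    refine one_sub_cos_pos (by positivity) ?_
    rw [div_le_iff₀ (by linarith)]
    nlinarith
  · exact h1

end RegularTriangulation

/-! ### From piecewise Lipschitz to Lipschitz. -/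

section LipschitzCover

/-- A function that is Lipschitz on each set of a finite closed cover of a real normed space is
Lipschitz. -/
lemma lipschitzWith_of_finite_closed_cover {ι E : Type*} [Finite ι] [NormedAddCommGroup E]
    [NormedSpace ℝ E] {A : ι → Set E} (hA : ∀ i, IsClosed (A i)) (hcov : ⋃ i, A i = Set.univ)
    {w : E → ℝ} {K : NNReal} (hw : ∀ i, LipschitzOnWith K w (A i)) : LipschitzWith K w := by
  have hcont : Continuous w :=
    (locallyFinite_of_finite A).continuous hcov hA fun i => (hw i).continuousOn
  refine LipschitzWith.of_dist_le_mul fun y x => ?_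
  set γ : ℝ → E := fun t => x + t • (y - x) with hγ
  have hγc : Continuous γ := by fun_prop
  have hγd : ∀ s t, s ≤ t → dist (γ t) (γ s) = (t - s) * dist y x := by
    intro s t hst
    rw [dist_eq_norm, dist_eq_norm, hγ]
    have : x + t • (y - x) - (x + s • (y - x)) = (t - s) • (y - x) := by module
    dsimp only
    rw [this, norm_smul, Real.norm_of_nonneg (by linarith)]
  set S : Set ℝ := {t | dist (w (γ t)) (w x) ≤ K * (t * dist y x)} with hS
  have hSc : IsClosed S := isClosed_le (by fun_prop) (by fun_prop)
  have h0 : γ 0 = x := by simp [hγ]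
  have hsub : Set.Icc (0 : ℝ) 1 ⊆ S := by
    refine (hSc.inter isClosed_Icc).Icc_subset_of_forall_exists_gt (by simp [hS, h0]) ?_
    rintro t ⟨htS, -⟩ u hu
    -- Continuity induction along the segment: one of the finitely many sets is met at parameters
    -- arbitrarily close to `t` from the right, and being closed it also contains `γ t`.
    obtain ⟨i, hi⟩ : ∃ i, ∃ᶠ s in 𝓝[>] t, γ s ∈ A i := by
      by_contra hcon
      push Not at hcon
      have h1 : ∀ᶠ s in 𝓝[>] t, ∀ i, γ s ∉ A i :=
        Filter.eventually_all.2 hcon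
      obtain ⟨s, hs⟩ := h1.exists
      have : γ s ∈ ⋃ i, A i := by rw [hcov]; trivial
      obtain ⟨i, hi⟩ := Set.mem_iUnion.1 this
      exact hs i hi
    have hti : γ t ∈ A i := by
      have hcl : IsClosed (γ ⁻¹' A i) := (hA i).preimage hγc
      have : t ∈ closure (γ ⁻¹' A i) :=
        mem_closure_iff_frequently.2 (hi.filter_mono nhdsWithin_le_nhds)
      rwa [hcl.closure_eq] at this
    obtain ⟨s, hs, hst⟩ := (hi.and_eventually (Ioc_mem_nhdsGT hu)).exists
    refine ⟨s, ?_, hst⟩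
    have h1 := (hw i).dist_le_mul _ hs _ hti
    rw [hγd t s hst.1.le] at h1
    have h2 := dist_triangle (w (γ s)) (w (γ t)) (w x)
    have htS' : dist (w (γ t)) (w x) ≤ K * (t * dist y x) := htS
    change dist (w (γ s)) (w x) ≤ K * (s * dist y x)
    calc _ ≤ _ := h2
      _ ≤ K * ((s - t) * dist y x) + K * (t * dist y x) := add_le_add h1 htS'
      _ = _ := by ring
  have h1 : dist (w (γ 1)) (w x) ≤ K * (1 * dist y x) := hsub (Set.right_mem_Icc.2 zero_le_one)
  have h2 : γ 1 = y := by simp [hγ]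
  rwa [h2, one_mul] at h1

end LipschitzCover

/-! ### Smooth approximation of Lipschitz functions. -/

section Mollification

open scoped Convolution

/-- Averaging over small translates preserves the Lipschitz constant and enlarges the support only
slightly. It changes an affine function only by a constant, so the gradient is exact where `f` is
affine on a ball of radius `2 * δ`. -/
lemma exists_mollification {Ω : Set Plane} (hΩ : IsOpen Ω) {f : Plane → ℝ} {K : NNReal}
    (hf : LipschitzWith K f) {S : Set Plane} (hS : IsCompact S) (hSΩ : S ⊆ Ω)
    (hfS : ∀ x, x ∉ S → f x = 0) {δ : ℝ} (hδ : 0 < δ) :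
    ∃ φ : Plane → ℝ, ContDiff ℝ ∞ φ ∧ HasCompactSupport φ ∧ tsupport φ ⊆ Ω ∧
      LipschitzWith K φ ∧ (∀ x, |φ x - f x| ≤ K * δ) ∧
      ∀ (p : Plane →ᵃ[ℝ] ℝ) (x : Plane), (∀ y ∈ Metric.ball x (2 * δ), f y = p y) →
        ∃ c : ℝ, φ =ᶠ[𝓝 x] fun y => p y + c := by
  -- The kernel radius is capped by `δ'`, so that the thickened support stays in `Ω`.
  obtain ⟨δ', hδ', hsub⟩ := hS.exists_cthickening_subset_open hΩ hSΩ
  set r := min δ δ' with hr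
  have hr0 : 0 < r := lt_min hδ hδ'
  let η : ContDiffBump (0 : Plane) := ⟨r / 2, r, by positivity, by linarith⟩
  have hη : η.rOut = r := rfl
  set ρ : Plane → ℝ := η.normed volume with hρ
  have hρ0 : ∀ t, 0 ≤ ρ t := η.nonneg_normed
  have hρi : Integrable ρ volume := η.integrable_normed
  have hρ1 : ∫ t, ρ t = 1 := η.integral_normed
  have hρs : Function.support ρ = Metric.ball 0 r := η.support_normed_eq
  have hρc : Continuous ρ := η.continuous_normed
  have hρcs : HasCompactSupport ρ := η.hasCompactSupport_normed
  have hfc : Continuous f := hf.continuous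
  let φ : Plane → ℝ := ρ ⋆[ContinuousLinearMap.lsmul ℝ ℝ, volume] f
  have hφ : ∀ x, φ x = ∫ t, ρ t * f (x - t) := fun x => rfl
  have hint : ∀ g : Plane → ℝ, Continuous g → Integrable (fun t => ρ t * g t) volume := by
    intro g hg
    exact (hρc.mul hg).integrable_of_hasCompactSupport hρcs.mul_right
  have hfsupp : Function.support f ⊆ S := by
    intro x hx
    by_contra h
    exact hx (hfS x h)
  have hsupp : tsupport φ ⊆ Metric.cthickening r S := by
    refine closure_minimal ?_ Metric.isClosed_cthickening
    refine (support_convolution_subset (ContinuousLinearMap.lsmul ℝ ℝ)).trans ?_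
    rintro _ ⟨t, ht, y, hy, rfl⟩
    rw [hρs, mem_ball_zero_iff] at ht
    refine Metric.mem_cthickening_of_dist_le _ y _ _ (hfsupp hy) ?_
    dsimp only
    rw [dist_eq_norm, add_sub_cancel_right]
    exact ht.le
  refine ⟨φ, ?_, ?_, ?_, ?_, ?_, ?_⟩
  · exact hρcs.contDiff_convolution_left _ η.contDiff_normed hfc.locallyIntegrable
  · exact HasCompactSupport.of_support_subset_isCompact hS.cthickening
      ((subset_tsupport _).trans hsupp)
  · exact hsupp.trans ((Metric.cthickening_mono (min_le_right _ _) S).trans hsub)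
  · refine LipschitzWith.of_dist_le_mul fun x y => ?_
    rw [hφ, hφ, Real.dist_eq, ← integral_sub (hint _ (by fun_prop)) (hint _ (by fun_prop))]
    have hb : ∀ t, ‖ρ t * f (x - t) - ρ t * f (y - t)‖ ≤ ρ t * (K * dist x y) := by
      intro t
      rw [← mul_sub, norm_mul, Real.norm_of_nonneg (hρ0 t)]
      refine mul_le_mul_of_nonneg_left ?_ (hρ0 t)
      have := hf.dist_le_mul (x - t) (y - t)
      rwa [dist_sub_right] at this
    refine (norm_integral_le_of_norm_le (hρi.mul_const _) (Eventually.of_forall hb)).trans ?_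
    rw [integral_mul_const, hρ1, one_mul]
  · intro x
    have := η.dist_normed_convolution_le (μ := volume) (g := f) (x₀ := x) (ε := K * δ)
      hfc.aestronglyMeasurable (by
        intro y hy
        rw [hη, Metric.mem_ball] at hy
        refine (hf.dist_le_mul y x).trans ?_
        gcongr
        exact hy.le.trans (min_le_left _ _))
    exact this
  · intro p x hp
    have hlin : ∀ y t, p (y - t) = p y - p.linear t := by
      intro y t
      have := p.map_vadd y (-t)
      rw [map_neg] at this
      simpa [sub_eq_add_neg, add_comm] using this
    have hlc : Continuous p.linear := p.linear.continuous_of_finiteDimensional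
    refine ⟨- ∫ t, ρ t * p.linear t, ?_⟩
    filter_upwards [Metric.ball_mem_nhds x hδ] with y hy
    rw [hφ, ← sub_eq_add_neg]
    have h1 : ∀ t, ρ t * f (y - t) = ρ t * p y - ρ t * p.linear t := by
      intro t
      by_cases ht : ρ t = 0
      · simp [ht]
      · have htb : t ∈ Metric.ball (0 : Plane) r := by rw [← hρs]; exact ht
        rw [mem_ball_zero_iff] at htb
        rw [hp, hlin, mul_sub]
        rw [Metric.mem_ball] at hy ⊢
        calc dist (y - t) x ≤ dist (y - t) y + dist y x := dist_triangle _ _ _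
          _ = ‖t‖ + dist y x := by rw [dist_eq_norm]; simp
          _ < 2 * δ := by
            have := min_le_left δ δ'
            linarith
    simp_rw [h1]
    rw [integral_sub (hρi.mul_const _) (hint _ hlc), integral_mul_const, hρ1, one_mul]

end Mollification

section Gradient

lemma norm_gradient_le {f : Plane → ℝ} {K : NNReal} (hf : LipschitzWith K f) (x : Plane) :
    ‖gradient f x‖ ≤ K := by
  rw [gradient, LinearIsometryEquiv.norm_map]
  exact norm_fderiv_le_of_lipschitz ℝ hf

lemma measurable_gradient (f : Plane → ℝ) : Measurable (gradient f) := by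
  have : Continuous (InnerProductSpace.toDual ℝ Plane).symm := LinearIsometryEquiv.continuous _
  exact this.measurable.comp (measurable_fderiv ℝ f)

lemma gradient_congr {f g : Plane → ℝ} {x : Plane} {c : ℝ}
    (h : f =ᶠ[𝓝 x] fun y => g y + c) : gradient f x = gradient g x := by
  rw [gradient, gradient, h.fderiv_eq, fderiv_add_const]

end Gradient

/-! ### Soft thresholding, used to make supports compact in the domain. -/

section SoftThreshold

/-- The soft threshold function. -/
noncomputable def softThreshold (ε t : ℝ) : ℝ := t - max (-ε) (min ε t)

lemma softThreshold_lipschitz (ε : ℝ) : LipschitzWith 2 (softThreshold ε) := by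
  have h1 : LipschitzWith 1 fun t : ℝ => max (-ε) (min ε t) :=
    (LipschitzWith.id.const_min ε).const_max (-ε)
  have := LipschitzWith.id.sub h1
  rwa [one_add_one_eq_two] at this

lemma softThreshold_of_abs_le {ε t : ℝ} (h : |t| ≤ ε) : softThreshold ε t = 0 := by
  rw [softThreshold, min_eq_right (abs_le.1 h).2, max_eq_right (abs_le.1 h).1, sub_self]

lemma softThreshold_of_le {ε t : ℝ} (h0 : 0 ≤ ε) (h : ε ≤ t) : softThreshold ε t = t + -ε := by
  rw [softThreshold, min_eq_left h, max_eq_right (by linarith), sub_eq_add_neg]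

lemma softThreshold_of_le_neg {ε t : ℝ} (h0 : 0 ≤ ε) (h : t ≤ -ε) :
    softThreshold ε t = t + ε := by
  rw [softThreshold, min_eq_right (by linarith), max_eq_left h, sub_neg_eq_add]

lemma abs_softThreshold_sub_le {ε : ℝ} (h0 : 0 ≤ ε) (t : ℝ) : |softThreshold ε t - t| ≤ ε := by
  rw [softThreshold, sub_sub_cancel_left, abs_neg, abs_le]
  exact ⟨le_max_left _ _, max_le (by linarith) (min_le_left _ _)⟩

end SoftThreshold

/-! ### A criterion for membership in `H¹₀`. -/

section Sobolev

/-- A Lipschitz function that vanishes outside the bounded open set `Ω` and is locally affine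
almost everywhere belongs to `H¹₀(Ω)`. -/
lemma memH10_of_lipschitz {Ω : Set Plane} (hΩ : IsOpen Ω) (hb : Bornology.IsBounded Ω)
    {w : Plane → ℝ} {K : NNReal} (hw : LipschitzWith K w) (hw0 : ∀ x, x ∉ Ω → w x = 0)
    (hloc : ∀ᵐ x ∂volume.restrict Ω, ∃ p : Plane →ᵃ[ℝ] ℝ, w =ᶠ[𝓝 x] p ∧
      (w x = 0 → ∀ y, p y = 0)) : MemH10 Ω w := by
  have hwc : Continuous w := hw.continuous
  have hfin : IsFiniteMeasure (volume.restrict Ω) :=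
    ⟨by rw [Measure.restrict_apply_univ]; exact hb.measure_lt_top⟩
  have hcs : HasCompactSupport w := by
    refine HasCompactSupport.intro hb.isCompact_closure fun x hx => hw0 x fun h => ?_
    exact hx (subset_closure h)
  refine ⟨(hwc.memLp_of_hasCompactSupport hcs).restrict _, gradient w, ?_, ?_⟩
  · exact MemLp.of_bound (measurable_gradient w).aestronglyMeasurable K
      (Eventually.of_forall fun x => norm_gradient_le hw x)
  set ε : ℕ → ℝ := fun n => 1 / ((n : ℝ) + 1) with hε
  have hε0 : ∀ n, 0 < ε n := fun n => Nat.one_div_pos_of_nat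
  have hεt : Tendsto ε atTop (𝓝 0) := tendsto_one_div_add_atTop_nhds_zero_nat
  have hSc : ∀ n, IsCompact {x | ε n ≤ |w x|} := by
    intro n
    refine Metric.isCompact_of_isClosed_isBounded (isClosed_le continuous_const (by fun_prop)) ?_
    refine hb.subset fun x hx => ?_
    by_contra h
    have hx' : ε n ≤ |w x| := hx
    rw [hw0 x h, abs_zero] at hx'
    linarith [hε0 n]
  have hSΩ : ∀ n, {x | ε n ≤ |w x|} ⊆ Ω := by
    intro n x hx
    by_contra h
    have hx' : ε n ≤ |w x| := hx
    rw [hw0 x h, abs_zero] at hx'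
    linarith [hε0 n]
  have hfL : ∀ n, LipschitzWith (2 * K) fun x => softThreshold (ε n) (w x) :=
    fun n => (softThreshold_lipschitz (ε n)).comp hw
  -- Since `w` vanishes off `Ω`, thresholding at `ε n` leaves a function supported in the compact
  -- set `{ε n ≤ |w|} ⊆ Ω`, which can be mollified within `Ω`.
  choose φ hφ1 hφ2 hφ3 hφ4 hφ5 hφ6 using fun n => exists_mollification hΩ (hfL n) (hSc n) (hSΩ n)
    (fun x hx => softThreshold_of_abs_le (not_le.1 hx).le) (hε0 n)
  refine ⟨φ, fun n => ⟨hφ1 n, hφ2 n, hφ3 n⟩, ?_, ?_⟩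
  · have hbd : ∀ n, eLpNorm (fun x => φ n x - w x) 2 (volume.restrict Ω)
        ≤ (volume.restrict Ω) Set.univ ^ ((2 : ℝ≥0∞).toReal)⁻¹
          * ENNReal.ofReal (((2 * K : NNReal) : ℝ) * ε n + ε n) := by
      intro n
      refine eLpNorm_le_of_ae_bound (Eventually.of_forall fun x => ?_)
      calc ‖φ n x - w x‖ = |(φ n x - softThreshold (ε n) (w x))
            + (softThreshold (ε n) (w x) - w x)| := by rw [Real.norm_eq_abs]; congr 1; ring
        _ ≤ _ := abs_add_le _ _
        _ ≤ _ := add_le_add (hφ5 n x) (abs_softThreshold_sub_le (hε0 n).le _)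
    refine tendsto_of_tendsto_of_tendsto_of_le_of_le tendsto_const_nhds ?_
      (fun _ => zero_le) hbd
    have h1 : Tendsto (fun n => ((2 * K : NNReal) : ℝ) * ε n + ε n) atTop (𝓝 0) := by
      simpa using (hεt.const_mul ((2 * K : NNReal) : ℝ)).add hεt
    have h2 := ENNReal.tendsto_ofReal h1
    rw [ENNReal.ofReal_zero] at h2
    have h3 := ENNReal.Tendsto.const_mul (a := (volume.restrict Ω) Set.univ ^
      ((2 : ℝ≥0∞).toReal)⁻¹) h2 (Or.inr (ENNReal.rpow_ne_top_of_nonneg (by positivity)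
        (measure_ne_top _ _)))
    rwa [mul_zero] at h3
  -- Near almost every point `w` is affine and either identically zero or bounded away from zero.
  -- There, thresholding gives zero or shifts `w` by a constant, so for large `n` the gradients
  -- agree exactly.
  · have hpt : ∀ᵐ x ∂volume.restrict Ω, ∀ᶠ n in atTop, gradient (φ n) x = gradient w x := by
      filter_upwards [hloc] with x hx
      obtain ⟨p, hp, hp0⟩ := hx
      have hgw : gradient w x = gradient p x :=
        gradient_congr (c := 0) (by simpa using hp)
      by_cases hwx : w x = 0
      · have hp' : ∀ᶠ y in 𝓝 x, w y = 0 := hp.mono fun y hy => hy.trans (hp0 hwx y)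
        obtain ⟨r, hr, hball⟩ := Metric.eventually_nhds_iff_ball.1 hp'
        filter_upwards [hεt.eventually (gt_mem_nhds (show (0 : ℝ) < r / 2 by linarith))] with n hn
        obtain ⟨c, hc⟩ := hφ6 n p x (by
          intro y hy
          rw [hball y (Metric.ball_subset_ball (by linarith) hy), hp0 hwx]
          exact softThreshold_of_abs_le (by rw [abs_zero]; exact (hε0 n).le))
        rw [hgw, gradient_congr hc]
      · have hpos : 0 < |w x| / 2 := by have := abs_pos.2 hwx; linarith
        rcases lt_or_gt_of_ne hwx with hneg | hpos'
        · have h2 : ∀ᶠ y in 𝓝 x, w y < - (|w x| / 2) :=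
            hwc.continuousAt.eventually (gt_mem_nhds (by rw [abs_of_neg hneg]; linarith))
          obtain ⟨r, hr, hball⟩ := Metric.eventually_nhds_iff_ball.1 (hp.and h2)
          filter_upwards [hεt.eventually (gt_mem_nhds (show (0 : ℝ) < r / 2 by linarith)),
            hεt.eventually (gt_mem_nhds hpos)] with n hn hn2
          obtain ⟨c, hc⟩ := hφ6 n (p + AffineMap.const ℝ Plane (ε n)) x (by
            intro y hy
            obtain ⟨e1, e2⟩ := hball y (Metric.ball_subset_ball (by linarith) hy)
            rw [softThreshold_of_le_neg (hε0 n).le (by linarith), e1]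
            rfl)
          rw [hgw, gradient_congr (g := p) (c := ε n + c)]
          filter_upwards [hc] with y hy
          rw [hy, ← add_assoc]
          rfl
        · have h2 : ∀ᶠ y in 𝓝 x, |w x| / 2 < w y :=
            hwc.continuousAt.eventually (lt_mem_nhds (by rw [abs_of_pos hpos']; linarith))
          obtain ⟨r, hr, hball⟩ := Metric.eventually_nhds_iff_ball.1 (hp.and h2)
          filter_upwards [hεt.eventually (gt_mem_nhds (show (0 : ℝ) < r / 2 by linarith)),
            hεt.eventually (gt_mem_nhds hpos)] with n hn hn2
          obtain ⟨c, hc⟩ := hφ6 n (p + AffineMap.const ℝ Plane (-ε n)) x (by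
            intro y hy
            obtain ⟨e1, e2⟩ := hball y (Metric.ball_subset_ball (by linarith) hy)
            rw [softThreshold_of_le (hε0 n).le (by linarith), e1]
            rfl)
          rw [hgw, gradient_congr (g := p) (c := -ε n + c)]
          filter_upwards [hc] with y hy
          rw [hy, ← add_assoc]
          rfl
    have hbd : ∀ n x, ‖gradient (φ n) x - gradient w x‖ₑ ≤ ENNReal.ofReal (3 * K) := by
      intro n x
      rw [← ofReal_norm]
      refine ENNReal.ofReal_le_ofReal ((norm_sub_le _ _).trans ?_)
      have h1 := norm_gradient_le (hφ4 n) x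
      have h2 := norm_gradient_le hw x
      push_cast at h1
      linarith
    -- The dominating constant `3 * K` is `2 * K` for the approximations plus `K` for `w`.
    have hlim := tendsto_lintegral_of_dominated_convergence (μ := volume.restrict Ω)
      (F := fun n x => ‖gradient (φ n) x - gradient w x‖ₑ ^ (2 : ℝ)) (f := fun _ => 0)
      (fun _ => ENNReal.ofReal (3 * K) ^ (2 : ℝ))
      (fun n => (((measurable_gradient _).sub (measurable_gradient _)).enorm).pow_const _)
      (fun n => Eventually.of_forall fun x => ENNReal.rpow_le_rpow (hbd n x) zero_le_two)
      (by
        rw [lintegral_const]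
        exact ENNReal.mul_ne_top (ENNReal.rpow_ne_top_of_nonneg zero_le_two
          ENNReal.ofReal_ne_top) (measure_ne_top _ _))
      (by
        filter_upwards [hpt] with x hx
        refine tendsto_const_nhds.congr' ?_
        filter_upwards [hx] with n hn
        rw [hn, sub_self, enorm_zero, ENNReal.zero_rpow_of_pos zero_lt_two])
    simp only [lintegral_zero] at hlim
    have h2 := (ENNReal.continuous_rpow_const (y := (1 / 2 : ℝ))).tendsto 0 |>.comp hlim
    rw [ENNReal.zero_rpow_of_pos (by norm_num)] at h2
    refine h2.congr fun n => ?_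
    rw [eLpNorm_eq_lintegral_rpow_enorm_toReal two_ne_zero ENNReal.ofNat_ne_top]
    simp
end Sobolev

/-! ### Affine interpolation on a triangle. -/

section AffineInterpolation

/-- The cross product with a fixed vector as a linear map. -/
def crossLinear (w : Plane) : Plane →ₗ[ℝ] ℝ where
  toFun u := cross u w
  map_add' u u' := cross_add_left u u' w
  map_smul' c u := cross_smul_left c u w

lemma exists_affineMap_eq {T : Finset Plane} {z a b : Plane} (h : IsFrame T z a b)
    (g : Plane → ℝ) : ∃ p : Plane →ᵃ[ℝ] ℝ, ∀ y ∈ T, p y = g y := by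
  set D := cross (a - z) (b - z) with hD
  have hD0 : D ≠ 0 := h.2.ne'
  -- Cramer's rule for `L (a - z) = g a - g z` and `L (b - z) = g b - g z`; the minus sign
  -- compensates the antisymmetry of the cross product.
  set L : Plane →ₗ[ℝ] ℝ := ((g a - g z) / D) • crossLinear (b - z)
    - ((g b - g z) / D) • crossLinear (a - z) with hL
  refine ⟨AffineMap.mk' (fun x => L (x - z) + g z) L z fun x => by simp, fun y hy => ?_⟩
  have hLx : ∀ x, L x = (g a - g z) / D * cross x (b - z) - (g b - g z) / D * cross x (a - z) :=
    fun x => rfl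
  rw [AffineMap.coe_mk', hLx]
  rcases h.mem_iff.1 hy with rfl | rfl | rfl
  · simp [cross_zero_left]
  · rw [cross_self, ← hD]
    field_simp
    ring
  · rw [cross_self, cross_comm, ← hD]
    field_simp
    ring

lemma affineMap_eq_of_mem_convexHull {S : Set Plane} {p q : Plane →ᵃ[ℝ] ℝ}
    (h : ∀ y ∈ S, p y = q y) {x : Plane} (hx : x ∈ convexHull ℝ S) : p x = q x := by
  have hconv : Convex ℝ ((p - q) ⁻¹' {0}) := (convex_singleton (0 : ℝ)).affine_preimage (p - q)
  have := convexHull_min (t := (p - q) ⁻¹' {0}) (fun y hy => by simp [h y hy]) hconv hx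
  have h2 : p x - q x = 0 := this
  linarith

lemma exists_lipschitzWith_affineMap (p : Plane →ᵃ[ℝ] ℝ) : ∃ K : NNReal, LipschitzWith K p := by
  refine ⟨‖LinearMap.toContinuousLinearMap p.linear‖₊, LipschitzWith.of_dist_le_mul fun x y => ?_⟩
  have h := p.linearMap_vsub x y
  rw [dist_eq_norm, dist_eq_norm]
  have h2 : p x - p y = LinearMap.toContinuousLinearMap p.linear (x - y) := h.symm
  rw [h2]
  exact ContinuousLinearMap.le_opNorm _ _

lemma affineMap_eq_of_isFrame {T : Finset Plane} {z a b : Plane} (h : IsFrame T z a b)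
    (p : Plane →ᵃ[ℝ] ℝ) (x : Plane) :
    p x = (1 - baryA z a b x - baryB z a b x) * p z + baryA z a b x * p a
      + baryB z a b x * p b := by
  conv_lhs => rw [eq_add_bary h.2.ne' x]
  rw [affineMap_apply_bary]

end AffineInterpolation

/-! ### Conformity of the averaged function. -/

namespace RegularTriangulation

variable {Ω : Set Plane} {𝒯 : RegularTriangulation Ω} {T : Finset Plane} {x z : Plane}

lemma affineInterp_apply (hT : T ∈ 𝒯.cells) (g : Plane → ℝ) (hz : z ∈ T) :
    affineInterp T g z = g z := by
  have h : ∃ p : Plane →ᵃ[ℝ] ℝ, ∀ z ∈ T, p z = g z := by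
    obtain ⟨a, b, hf⟩ := 𝒯.exists_isFrame hT hz
    exact exists_affineMap_eq hf g
  rw [affineInterp, dif_pos h]
  exact h.choose_spec z hz

/-- Two interpolants agree at the common vertices, hence on their hull, which is the intersection of
the triangles; the choice in `J1` is immaterial. -/
lemma J1_eq (v : Plane → ℝ) (hT : T ∈ 𝒯.cells) (hx : x ∈ hull T) :
    𝒯.J1 v x = affineInterp T (𝒯.nodalAverage v) x := by
  have h : ∃ T ∈ 𝒯.cells, x ∈ hull T := ⟨T, hT, hx⟩
  rw [J1, dif_pos h]
  obtain ⟨h1, h2⟩ := h.choose_spec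
  have hx' : x ∈ hull h.choose ∩ hull T := ⟨h2, hx⟩
  rw [𝒯.inter_eq _ h1 T hT] at hx'
  refine affineMap_eq_of_mem_convexHull (fun y hy => ?_) hx'
  rw [affineInterp_apply h1 _ hy.1, affineInterp_apply hT _ hy.2]

lemma ae_eq_piece {v : Plane → ℝ} (hv : 𝒯.MemP1 v) (hT : T ∈ 𝒯.cells) :
    v =ᵐ[volume.restrict (hull T)] piece v T := by
  have h := hv T hT
  rw [piece, dif_pos h]
  exact h.choose_spec

lemma memP1_J1 (v : Plane → ℝ) : 𝒯.MemP1 (𝒯.J1 v) := by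
  intro T hT
  refine ⟨affineInterp T (𝒯.nodalAverage v), ?_⟩
  filter_upwards [ae_restrict_mem (isClosed_hull T).measurableSet] with x hx
  exact J1_eq v hT hx

lemma interior_hull_subset (hΩ : interior (closure Ω) = Ω) (hT : T ∈ 𝒯.cells) :
    interior (hull T) ⊆ Ω := by
  rw [← hΩ]
  exact interior_mono (𝒯.hull_subset_closure hT)

/-- The open star of an interior node is contained in the domain. -/
lemma mem_of_interior_vertex (hΩ : interior (closure Ω) = Ω) (hT : T ∈ 𝒯.cells) {a b : Plane}
    (h : IsFrame T z a b) (hz : z ∈ Ω) (hx : x ∈ hull T)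
    (hlt : baryA z a b x + baryB z a b x < 1) : x ∈ Ω := by
  obtain ⟨hA, hB, -⟩ := (h.mem_hull_iff x).1 hx
  have hxe := eq_add_bary h.2.ne' x
  have hzf : z ∉ frontier Ω := by
    rw [frontier_eq hΩ]
    exact fun hc => hc.2 hz
  -- Four positions of `x`: interior to `T`, on one of the two sides at `z`, or equal to `z`. A side
  -- at `z` must be shared, since otherwise `z` would lie on the frontier.
  rcases hA.lt_or_eq with hA' | hA' <;> rcases hB.lt_or_eq with hB' | hB'
  · exact interior_hull_subset hΩ hT (h.mem_interior_hull hA' hB' hlt)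
  · rw [← hB'] at hxe hlt
    have hxe' : x = a + (1 - baryA z a b x) • (z - a) := by
      conv_lhs => rw [hxe]
      module
    by_cases hs : ∀ T' ∈ 𝒯.cells, a ∈ T' → z ∈ T' → T' = T
    · exact absurd (segment_subset_frontier hΩ hT h.rotate hs (right_mem_segment ℝ _ _)) hzf
    · push Not at hs
      obtain ⟨T', h1, h2, h3, h4⟩ := hs
      obtain ⟨c, hc⟩ := exists_isFrame_next hT h1 h.rotate h4 h2 h3
      rw [hxe']
      exact mem_of_shared_side hΩ hT h1 h.rotate hc (by linarith) (by linarith)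
  · rw [← hA'] at hxe hlt
    have hxe' : x = z + baryB z a b x • (b - z) := by
      conv_lhs => rw [hxe]
      module
    by_cases hs : ∀ T' ∈ 𝒯.cells, z ∈ T' → b ∈ T' → T' = T
    · exact absurd (segment_subset_frontier hΩ hT h hs (left_mem_segment ℝ _ _)) hzf
    · push Not at hs
      obtain ⟨T', h1, h2, h3, h4⟩ := hs
      obtain ⟨c, hc⟩ := exists_isFrame_next hT h1 h h4 h2 h3
      rw [hxe']
      exact mem_of_shared_side hΩ hT h1 h hc hB' (by linarith)
  · rw [← hA', ← hB'] at hxe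
    rw [hxe]
    simpa using hz

lemma nodalAverage_eq_zero (v : Plane → ℝ) (hz : z ∉ Ω) : 𝒯.nodalAverage v z = 0 := by
  rw [nodalAverage, if_neg]
  simp [interiorNodes, hz]

/-- Each product of a barycentric weight and a nodal value vanishes: the value is zero at a vertex
outside `Ω`, and a vertex in `Ω` has weight zero because `x` is outside its open star. -/
lemma J1_eq_zero (hΩ : interior (closure Ω) = Ω) (v : Plane → ℝ) (hx : x ∉ Ω) :
    𝒯.J1 v x = 0 := by
  by_cases hex : ∃ T ∈ 𝒯.cells, x ∈ hull T
  swap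
  · rw [J1, dif_neg hex]
  obtain ⟨T, hT, hxT⟩ := hex
  obtain ⟨z, hz⟩ : T.Nonempty := by
    rw [← Finset.card_pos, 𝒯.card_eq T hT]; norm_num
  obtain ⟨a, b, h⟩ := 𝒯.exists_isFrame hT hz
  obtain ⟨hA, hB, hAB⟩ := (h.mem_hull_iff x).1 hxT
  rw [J1_eq v hT hxT, affineMap_eq_of_isFrame h, affineInterp_apply hT _ h.fst_mem,
    affineInterp_apply hT _ h.snd_mem, affineInterp_apply hT _ h.thd_mem]
  have h1 : (1 - baryA z a b x - baryB z a b x) * 𝒯.nodalAverage v z = 0 := by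
    by_cases hzΩ : z ∈ Ω
    · have : ¬ baryA z a b x + baryB z a b x < 1 :=
        fun hc => hx (mem_of_interior_vertex hΩ hT h hzΩ hxT hc)
      rw [show 1 - baryA z a b x - baryB z a b x = 0 by linarith, zero_mul]
    · rw [nodalAverage_eq_zero v hzΩ, mul_zero]
  have h2 : baryA z a b x * 𝒯.nodalAverage v a = 0 := by
    by_cases haΩ : a ∈ Ω
    · have : ¬ baryA a b z x + baryB a b z x < 1 :=
        fun hc => hx (mem_of_interior_vertex hΩ hT h.rotate haΩ hxT hc)
      rw [baryA_rotate h, baryB_rotate h] at this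
      rw [show baryA z a b x = 0 by linarith, zero_mul]
    · rw [nodalAverage_eq_zero v haΩ, mul_zero]
  have h3 : baryB z a b x * 𝒯.nodalAverage v b = 0 := by
    by_cases hbΩ : b ∈ Ω
    · have : ¬ baryA b z a x + baryB b z a x < 1 :=
        fun hc => hx (mem_of_interior_vertex hΩ hT h.rotate.rotate hbΩ hxT hc)
      rw [baryA_rotate h.rotate, baryB_rotate h.rotate, baryB_rotate h, baryA_rotate h] at this
      rw [show baryB z a b x = 0 by linarith, zero_mul]
    · rw [nodalAverage_eq_zero v hbΩ, mul_zero]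
  rw [h1, h2, h3]
  norm_num

lemma exists_lipschitzWith_J1 (hΩ : interior (closure Ω) = Ω) (v : Plane → ℝ) :
    ∃ K : NNReal, LipschitzWith K (𝒯.J1 v) := by
  choose k hk using fun T : Finset Plane =>
    exists_lipschitzWith_affineMap (affineInterp T (𝒯.nodalAverage v))
  let A : Option {T // T ∈ 𝒯.cells} → Set Plane := fun o => o.elim Ωᶜ fun T => hull T.1
  refine ⟨𝒯.cells.sup k, lipschitzWith_of_finite_closed_cover (A := A) ?_ ?_ ?_⟩
  · rintro (_ | T)
    · exact (isOpen_of_interior_closure hΩ).isClosed_compl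
    · exact isClosed_hull T.1
  · refine Set.eq_univ_of_forall fun x => Set.mem_iUnion.2 ?_
    by_cases hx : x ∈ Ω
    · have := subset_closure hx
      rw [𝒯.closure_eq] at this
      simp only [Set.mem_iUnion] at this
      obtain ⟨T, hT, hxT⟩ := this
      exact ⟨some ⟨T, hT⟩, hxT⟩
    · exact ⟨none, hx⟩
  · rintro (_ | T)
    · intro x hx y hy
      rw [J1_eq_zero hΩ v hx, J1_eq_zero hΩ v hy, edist_self]
      exact zero_le
    · intro x hx y hy
      rw [J1_eq v T.2 hx, J1_eq v T.2 hy]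
      exact ((hk T.1).weaken (Finset.le_sup T.2)) x y

lemma volume_frontier_hull (T : Finset Plane) : volume (frontier (hull T)) = 0 :=
  (convex_hull T).addHaar_frontier volume

variable (𝒯) in
lemma ae_mem_interior_hull : ∀ᵐ x : Plane, x ∈ Ω → ∃ T ∈ 𝒯.cells, x ∈ interior (hull T) := by
  have h1 : ∀ᵐ x ∂(volume : Measure Plane), ∀ T ∈ 𝒯.cells, x ∉ frontier (hull T) :=
    (Finset.eventually_all _).2 fun T _ => compl_mem_ae_iff.2 (volume_frontier_hull T)
  filter_upwards [h1] with x hx hxΩ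
  have := subset_closure hxΩ
  rw [𝒯.closure_eq] at this
  simp only [Set.mem_iUnion] at this
  obtain ⟨T, hT, hxT⟩ := this
  refine ⟨T, hT, ?_⟩
  by_contra hc
  exact hx T hT ⟨subset_closure hxT, hc⟩

/-- The zero set of a nonzero affine function is a proper affine subspace, hence null. This discards
the points where `J₁v` changes sign inside a triangle. -/
lemma ae_affineMap_ne_zero (p : Plane →ᵃ[ℝ] ℝ) :
    ∀ᵐ x : Plane, p x = 0 → ∀ y, p y = 0 := by
  by_cases hp : ∀ y, p y = 0
  · exact Eventually.of_forall fun _ _ => hp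
  · push Not at hp
    obtain ⟨y, hy⟩ := hp
    set S : AffineSubspace ℝ Plane := (AffineSubspace.mk' (0 : ℝ) ⊥).comap p with hS
    have hmem : ∀ x, x ∈ S ↔ p x = 0 := by
      intro x
      rw [hS, AffineSubspace.mem_comap, AffineSubspace.mem_mk']
      simp
    have hne : S ≠ ⊤ := by
      intro h
      have : y ∈ S := by rw [h]; trivial
      exact hy ((hmem y).1 this)
    have h0 := Measure.addHaar_affineSubspace (volume : Measure Plane) S hne
    filter_upwards [compl_mem_ae_iff.2 h0] with x hx hpx
    exact absurd ((hmem x).2 hpx) hx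

lemma isBounded (𝒯 : RegularTriangulation Ω) : Bornology.IsBounded Ω := by
  refine Bornology.IsBounded.subset ?_ subset_closure
  rw [𝒯.closure_eq]
  exact (Bornology.isBounded_biUnion_finset _).2 fun T _ => (isCompact_hull T).isBounded

lemma memS10_J1 (hΩ : interior (closure Ω) = Ω) (v : Plane → ℝ) : 𝒯.MemS10 (𝒯.J1 v) := by
  refine ⟨memP1_J1 v, ?_⟩
  obtain ⟨K, hK⟩ := exists_lipschitzWith_J1 (𝒯 := 𝒯) hΩ v
  have hopen := isOpen_of_interior_closure hΩ
  refine memH10_of_lipschitz hopen 𝒯.isBounded hK (fun x hx => J1_eq_zero hΩ v hx) ?_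
  rw [ae_restrict_iff' hopen.measurableSet]
  have h2 : ∀ᵐ x : Plane, ∀ T ∈ 𝒯.cells, affineInterp T (𝒯.nodalAverage v) x = 0 →
      ∀ y, affineInterp T (𝒯.nodalAverage v) y = 0 :=
    (Finset.eventually_all _).2 fun T _ => ae_affineMap_ne_zero _
  filter_upwards [𝒯.ae_mem_interior_hull, h2] with x h1 h2 hx
  obtain ⟨T, hT, hxT⟩ := h1 hx
  refine ⟨affineInterp T (𝒯.nodalAverage v), ?_, fun h0 => h2 T hT ?_⟩
  · filter_upwards [isOpen_interior.mem_nhds hxT] with y hy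
    exact J1_eq v hT (interior_subset hy)
  · rw [← J1_eq v hT (interior_subset hxT), h0]

end RegularTriangulation

/-! ### Gradients of affine functions and `L²` norms. -/

section Energy

lemma gradient_affineMap (p : Plane →ᵃ[ℝ] ℝ) (x : Plane) :
    gradient p x = (InnerProductSpace.toDual ℝ Plane).symm
      (LinearMap.toContinuousLinearMap p.linear) := by
  have h : (p : Plane → ℝ) = fun y => LinearMap.toContinuousLinearMap p.linear y + p 0 := by
    ext y
    have := p.map_vadd 0 y
    simpa using this
  rw [gradient, h, fderiv_add_const, ContinuousLinearMap.fderiv]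

lemma sq_linear_le (p : Plane →ᵃ[ℝ] ℝ) (x u : Plane) :
    p.linear u ^ 2 ≤ ‖gradient p x‖ ^ 2 * ‖u‖ ^ 2 := by
  have h1 : p.linear u = inner ℝ (gradient p x) u := by
    rw [gradient_affineMap, InnerProductSpace.toDual_symm_apply]
    rfl
  rw [h1, ← mul_pow, ← sq_abs]
  exact pow_le_pow_left₀ (abs_nonneg _) (abs_real_inner_le_norm _ _) 2

lemma eLpNorm_two_le {f : Plane → ℝ} {g : Plane → Plane} {μ ν : Measure Plane} {X : ℝ}
    (h : ∫⁻ x, ‖f x‖ₑ ^ 2 ∂μ ≤ ENNReal.ofReal X * ∫⁻ x, ‖g x‖ₑ ^ 2 ∂ν) (hX : 0 ≤ X) :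
    eLpNorm f 2 μ ≤ ENNReal.ofReal (Real.sqrt X) * eLpNorm g 2 ν := by
  rw [eLpNorm_eq_lintegral_rpow_enorm_toReal two_ne_zero ENNReal.ofNat_ne_top,
    eLpNorm_eq_lintegral_rpow_enorm_toReal two_ne_zero ENNReal.ofNat_ne_top]
  simp only [ENNReal.toReal_ofNat, ENNReal.rpow_ofNat]
  refine (ENNReal.rpow_le_rpow h (by norm_num : (0 : ℝ) ≤ 1 / 2)).trans (le_of_eq ?_)
  rw [ENNReal.mul_rpow_of_nonneg _ _ (by norm_num), Real.sqrt_eq_rpow,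
    ENNReal.ofReal_rpow_of_nonneg hX (by norm_num)]

end Energy

/-! ### Summation over triangles and nodes. -/

namespace RegularTriangulation

variable {Ω : Set Plane} {𝒯 : RegularTriangulation Ω} {T T' : Finset Plane} {x z : Plane}

lemma eq_of_mem_interior (hT : T ∈ 𝒯.cells) (hT' : T' ∈ 𝒯.cells)
    (hx : x ∈ interior (hull T)) (hx' : x ∈ interior (hull T')) : T = T' := by
  refine eq_of_subset hT hT' fun y hy => ?_
  obtain ⟨a, b, h⟩ := 𝒯.exists_isFrame hT hy
  -- Moving in the direction `y - a` increases the barycentric coordinate at `y`, which becomes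
  -- positive while the point stays in both interiors; then `y` is a vertex of `T'`.
  set γ : ℝ → Plane := fun t => x + t • (y - a) with hγ
  have ht : Tendsto γ (𝓝 0) (𝓝 x) := by
    have h0 : γ 0 = x := by simp [hγ]
    have : Continuous γ := by fun_prop
    conv_rhs => rw [← h0]
    exact this.tendsto 0
  have ev : ∀ᶠ t in 𝓝[>] (0 : ℝ), (γ t ∈ interior (hull T) ∧ γ t ∈ interior (hull T')) ∧ 0 < t :=
    Filter.Eventually.and (nhdsWithin_le_nhds ((ht.eventually
      (isOpen_interior.eventually_mem hx)).and (ht.eventually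
      (isOpen_interior.eventually_mem hx')))) self_mem_nhdsWithin
  obtain ⟨t, ⟨h1, h2⟩, h3⟩ := ev.exists
  refine fst_mem_of_bary_lt hT hT' h (interior_subset h1) (interior_subset h2) ?_
  obtain ⟨-, -, h4⟩ := (h.mem_hull_iff x).1 (interior_subset hx)
  have h5 : γ t = y + ((baryA y a b x - t) • (a - y) + baryB y a b x • (b - y)) := by
    simp only [hγ]
    conv_lhs => rw [eq_add_bary h.2.ne' x]
    module
  rw [h5, baryA_add h.2.ne', baryB_add h.2.ne']
  linarith

lemma sum_indicator_interior {E : Type*} [AddCommMonoid E] (hT : T ∈ 𝒯.cells)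
    (hx : x ∈ interior (hull T)) (F : Finset Plane → Plane → E) :
    ∑ T ∈ 𝒯.cells, (interior (hull T)).indicator (F T) x = F T x := by
  rw [Finset.sum_eq_single_of_mem T hT, Set.indicator_of_mem hx]
  intro T' hT' hne
  exact Set.indicator_of_notMem (fun h => hne (eq_of_mem_interior hT' hT h hx)) _

lemma meshSize_eq (hT : T ∈ 𝒯.cells) (hx : x ∈ interior (hull T)) :
    𝒯.meshSize x = diamCell T :=
  sum_indicator_interior hT hx fun T _ => diamCell T

lemma gradNC_eq (v : Plane → ℝ) (hT : T ∈ 𝒯.cells) (hx : x ∈ interior (hull T)) :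
    𝒯.gradNC v x = gradient (piece v T) 0 := by
  have h1 : 𝒯.gradNC v x = gradient (piece v T) x :=
    sum_indicator_interior hT hx fun T y => gradient (piece v T) y
  rw [h1, gradient_affineMap, gradient_affineMap]

lemma lintegral_biUnion_interior {S : Finset (Finset Plane)} (hS : S ⊆ 𝒯.cells)
    (F : Plane → ℝ≥0∞) :
    ∫⁻ x in ⋃ T ∈ S, interior (hull T), F x = ∑ T ∈ S, ∫⁻ x in interior (hull T), F x := by
  refine lintegral_biUnion_finset ?_ (fun T _ => isOpen_interior.measurableSet) F
  intro T hT T' hT' hne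
  refine Set.disjoint_left.2 fun x hx hx' => hne ?_
  exact eq_of_mem_interior (hS hT) (hS hT') hx hx'

lemma volume_interior_hull (T : Finset Plane) : volume (interior (hull T)) = volume (hull T) :=
  measure_interior_of_null_frontier (volume_frontier_hull T)

lemma _root_.CrouzeixRaviart.IsFrame.volume_hull {a b : Plane} (h : IsFrame T z a b) :
    volume (hull T) = ENNReal.ofReal (cross (a - z) (b - z) / 2) := by
  rw [h.hull_eq, volume_convexHull_triple h.2.ne', abs_of_pos h.2]

/-- The squared norm of the gradient of `v` on the triangle `T`. -/
noncomputable def cellEnergy (v : Plane → ℝ) (T : Finset Plane) : ℝ :=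
  (volume (hull T)).toReal * ‖gradient (piece v T) 0‖ ^ 2

lemma cellEnergy_nonneg (v : Plane → ℝ) (T : Finset Plane) : 0 ≤ cellEnergy v T := by
  unfold cellEnergy; positivity

lemma ofReal_sum_cellEnergy_le (v : Plane → ℝ) {S : Finset (Finset Plane)} (hS : S ⊆ 𝒯.cells)
    {s : Set Plane} (hs : ∀ T ∈ S, interior (hull T) ⊆ s) :
    ENNReal.ofReal (∑ T ∈ S, cellEnergy v T) ≤ ∫⁻ x in s, ‖𝒯.gradNC v x‖ₑ ^ 2 := by
  calc ENNReal.ofReal (∑ T ∈ S, cellEnergy v T)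
      = ∑ T ∈ S, ∫⁻ x in interior (hull T), ‖𝒯.gradNC v x‖ₑ ^ 2 := by
        rw [ENNReal.ofReal_sum_of_nonneg fun T _ => cellEnergy_nonneg v T]
        refine Finset.sum_congr rfl fun T hT => ?_
        rw [setLIntegral_congr_fun (g := fun _ => ‖gradient (piece v T) 0‖ₑ ^ 2)
          isOpen_interior.measurableSet (fun x hx => by
            dsimp only; rw [gradNC_eq v (hS hT) hx]), setLIntegral_const, volume_interior_hull,
          cellEnergy, ENNReal.ofReal_mul ENNReal.toReal_nonneg,
          ENNReal.ofReal_toReal (isCompact_hull T).measure_lt_top.ne,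
          ENNReal.ofReal_pow (norm_nonneg _), ofReal_norm, mul_comm]
    _ = ∫⁻ x in ⋃ T ∈ S, interior (hull T), ‖𝒯.gradNC v x‖ₑ ^ 2 :=
        (lintegral_biUnion_interior hS _).symm
    _ ≤ _ := lintegral_mono_set (Set.iUnion₂_subset hs)

lemma norm_sub_le_diamCell {y y' : Plane} (hy : y ∈ T) (hy' : y' ∈ T) :
    ‖y - y'‖ ≤ diamCell T := by
  rw [← dist_eq_norm]
  exact Metric.dist_le_diam_of_mem (isCompact_hull T).isBounded (subset_hull hy) (subset_hull hy')

/-- Weitzenböck's inequality with all three sides at most the diameter; equality holds for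
equilateral triangles. -/
lemma _root_.CrouzeixRaviart.IsFrame.cross_le_diamCell {a b : Plane} (h : IsFrame T z a b) :
    cross (a - z) (b - z) ≤ Real.sqrt 3 / 2 * diamCell T ^ 2 := by
  have h1 := cross_le_sum_sq_sides z a b
  have h2 := pow_le_pow_left₀ (norm_nonneg _) (norm_sub_le_diamCell h.snd_mem h.fst_mem) 2
  have h3 := pow_le_pow_left₀ (norm_nonneg _) (norm_sub_le_diamCell h.thd_mem h.fst_mem) 2
  have h4 := pow_le_pow_left₀ (norm_nonneg _) (norm_sub_le_diamCell h.thd_mem h.snd_mem) 2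
  have h5 : Real.sqrt 3 * Real.sqrt 3 = 3 := Real.mul_self_sqrt (by norm_num)
  have h6 : 0 < Real.sqrt 3 := Real.sqrt_pos.2 (by norm_num)
  have h7 : 2 * Real.sqrt 3 * cross (a - z) (b - z)
      ≤ 2 * Real.sqrt 3 * (Real.sqrt 3 / 2 * diamCell T ^ 2) := by
    calc _ ≤ 3 * diamCell T ^ 2 := by linarith
      _ = Real.sqrt 3 * Real.sqrt 3 * diamCell T ^ 2 := by rw [h5]
      _ = _ := by ring
  exact le_of_mul_le_mul_left h7 (by positivity)

lemma _root_.CrouzeixRaviart.IsFrame.diamCell_pos {a b : Plane} (h : IsFrame T z a b) : 0 < diamCell T :=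
  (norm_pos_iff.2 (sub_ne_zero.2 h.snd_ne)).trans_le (norm_sub_le_diamCell h.snd_mem h.fst_mem)

variable (𝒯) in
/-- The sum of the squared nodal errors on the triangle `T`. -/
noncomputable def nodalError (v : Plane → ℝ) (T : Finset Plane) : ℝ :=
  ∑ z ∈ T, (piece v T z - 𝒯.nodalAverage v z) ^ 2

lemma nodalError_nonneg (v : Plane → ℝ) (T : Finset Plane) : 0 ≤ 𝒯.nodalError v T :=
  Finset.sum_nonneg fun _ _ => sq_nonneg _

lemma exists_isFrame' (hT : T ∈ 𝒯.cells) : ∃ z a b, IsFrame T z a b := by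
  obtain ⟨z, hz⟩ : T.Nonempty := by
    rw [← Finset.card_pos, 𝒯.card_eq T hT]; norm_num
  exact ⟨z, 𝒯.exists_isFrame hT hz⟩

lemma lintegral_cell_le {v : Plane → ℝ} (hv : 𝒯.MemP1 v) (hT : T ∈ 𝒯.cells) :
    ∫⁻ x in hull T, ‖(diamCell T)⁻¹ * (v x - 𝒯.J1 v x)‖ₑ ^ 2
      ≤ ENNReal.ofReal (Real.sqrt 3 / 12 * 𝒯.nodalError v T) := by
  obtain ⟨z, a, b, h⟩ := exists_isFrame' hT
  set p : Plane →ᵃ[ℝ] ℝ := (diamCell T)⁻¹ • (piece v T - affineInterp T (𝒯.nodalAverage v))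
    with hp
  have hpx : ∀ x, p x = (diamCell T)⁻¹ * (piece v T x - affineInterp T (𝒯.nodalAverage v) x) :=
    fun x => rfl
  have h1 : ∫⁻ x in hull T, ‖(diamCell T)⁻¹ * (v x - 𝒯.J1 v x)‖ₑ ^ 2
      = ∫⁻ x in hull T, ENNReal.ofReal (p x ^ 2) := by
    refine lintegral_congr_ae ?_
    filter_upwards [ae_eq_piece hv hT, ae_restrict_mem (isClosed_hull T).measurableSet]
      with x hx hxT
    rw [hx, J1_eq v hT hxT, ← hpx, ← ofReal_norm, ← ENNReal.ofReal_pow (norm_nonneg _),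
      Real.norm_eq_abs, sq_abs]
  have hnode : ∀ y ∈ T, p y = (diamCell T)⁻¹ * (piece v T y - 𝒯.nodalAverage v y) := by
    intro y hy
    rw [hpx, affineInterp_apply hT _ hy]
  rw [h1, h.hull_eq]
  refine (lintegral_affine_sq_le h.2.ne' p).trans (ENNReal.ofReal_le_ofReal ?_)
  rw [abs_of_pos h.2, hnode z h.fst_mem, hnode a h.snd_mem, hnode b h.thd_mem, nodalError,
    h.sum_eq]
  have hd := h.diamCell_pos
  have hc := h.cross_le_diamCell
  -- The constant `√3 / 12` is the factor `1/6` from integration times `√3 / 2` from the area bound.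
  have hc' : cross (a - z) (b - z) / 6 * (diamCell T)⁻¹ ^ 2 ≤ Real.sqrt 3 / 12 := by
    rw [inv_pow, ← div_eq_mul_inv, div_le_iff₀ (by positivity)]
    linarith
  calc _ = (cross (a - z) (b - z) / 6 * (diamCell T)⁻¹ ^ 2) *
        ((piece v T z - 𝒯.nodalAverage v z) ^ 2 + ((piece v T a - 𝒯.nodalAverage v a) ^ 2
          + (piece v T b - 𝒯.nodalAverage v b) ^ 2)) := by ring
    _ ≤ _ := mul_le_mul_of_nonneg_right hc' (by positivity)

lemma _root_.CrouzeixRaviart.IsFrame.sum_sq_sides_le {ω₀ : ℝ} (hω₀ : 𝒯.IsMinAngleBound ω₀) (hT : T ∈ 𝒯.cells)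
    {a b : Plane} (h : IsFrame T z a b) :
    ‖a - z‖ ^ 2 + ‖b - z‖ ^ 2 + ‖b - a‖ ^ 2 ≤ 6 * cross (a - z) (b - z) * Real.cot ω₀ :=
  CrouzeixRaviart.sum_sq_sides_le hω₀.1 h.2
    (hω₀.2 T hT a h.snd_mem z h.fst_mem b h.thd_mem h.snd_ne h.thd_ne h.thd_ne_snd.symm)
    (hω₀.2 T hT b h.thd_mem a h.snd_mem z h.fst_mem h.thd_ne_snd h.snd_ne.symm h.thd_ne)
    (hω₀.2 T hT z h.fst_mem b h.thd_mem a h.snd_mem h.thd_ne.symm h.thd_ne_snd.symm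
      h.snd_ne.symm)

/-- The cotangent bounds a positive sum of squared sides, so one triangle suffices. -/
lemma cot_pos {ω₀ : ℝ} (hω₀ : 𝒯.IsMinAngleBound ω₀) (hT : T ∈ 𝒯.cells) : 0 < Real.cot ω₀ := by
  obtain ⟨z, a, b, h⟩ := exists_isFrame' hT
  have h1 := h.sum_sq_sides_le hω₀ hT
  have h2 : 0 < ‖a - z‖ := norm_pos_iff.2 (sub_ne_zero.2 h.snd_ne)
  have h3 : 0 < 6 * cross (a - z) (b - z) * Real.cot ω₀ := lt_of_lt_of_le (by positivity) h1
  exact pos_of_mul_pos_right h3 (by have := h.2; positivity)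

/-- Each side occurs with both orientations and the cross product is twice the area, so the constant
is `2 * 6 * 2 = 24`. -/
lemma sum_sq_linear_le {ω₀ : ℝ} (hω₀ : 𝒯.IsMinAngleBound ω₀) (v : Plane → ℝ)
    (hT : T ∈ 𝒯.cells) :
    ∑ z ∈ T, ∑ a ∈ T, ((piece v T).linear (a - z)) ^ 2
      ≤ 24 * Real.cot ω₀ * cellEnergy v T := by
  obtain ⟨z, a, b, h⟩ := exists_isFrame' hT
  have hs : ∀ y y' : Plane, (piece v T).linear (y' - y) ^ 2 = (piece v T).linear (y - y') ^ 2 := by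
    intro y y'
    rw [← neg_sub y y', map_neg, neg_sq]
  have e : ∑ z ∈ T, ∑ a ∈ T, ((piece v T).linear (a - z)) ^ 2
      = 2 * ((piece v T).linear (a - z) ^ 2 + (piece v T).linear (b - z) ^ 2
        + (piece v T).linear (b - a) ^ 2) := by
    rw [h.sum_eq, h.sum_eq, h.sum_eq, h.sum_eq, hs a z, hs b z, hs b a]
    simp only [sub_self, map_zero]
    ring
  rw [e, cellEnergy, h.volume_hull, ENNReal.toReal_ofReal (by linarith [h.2])]
  have h1 := sq_linear_le (piece v T) 0 (a - z)
  have h2 := sq_linear_le (piece v T) 0 (b - z)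
  have h3 := sq_linear_le (piece v T) 0 (b - a)
  have h4 := h.sum_sq_sides_le hω₀ hT
  have h5 := mul_le_mul_of_nonneg_left h4 (sq_nonneg ‖gradient (piece v T) 0‖)
  linarith

/-- The nodal errors at a set of nodes are controlled by the energy on the adjacent triangles. -/
lemma sum_nodes_le (hΩ : interior (closure Ω) = Ω) {ω₀ : ℝ} (hω₀ : 𝒯.IsMinAngleBound ω₀)
    {v : Plane → ℝ} (hv : 𝒯.MemCR10 v) {Z : Finset Plane} (hZ : Z ⊆ 𝒯.nodes)
    {S : Finset (Finset Plane)} (hS : S ⊆ 𝒯.cells)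
    (hZS : ∀ z ∈ Z, ∀ T ∈ 𝒯.cells, z ∈ T → T ∈ S) :
    4 * 𝒯.eigenvalueFactor *
        ∑ z ∈ Z, ∑ T ∈ 𝒯.cellsAt z, (piece v T z - 𝒯.nodalAverage v z) ^ 2
      ≤ 24 * Real.cot ω₀ * ∑ T ∈ S, cellEnergy v T := by
  classical
  rw [Finset.mul_sum, Finset.mul_sum]
  calc _ ≤ ∑ z ∈ Z, ∑ T ∈ 𝒯.cellsAt z, ∑ a ∈ T, ((piece v T).linear (a - z)) ^ 2 :=
        Finset.sum_le_sum fun z hz => node_estimate hΩ hv (hZ hz)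
    -- The order of summation is exchanged; then all vertices of `T` are admitted, as the terms are
    -- nonnegative.
    _ = ∑ T ∈ S, ∑ z ∈ Z.filter (fun z => z ∈ T), ∑ a ∈ T, ((piece v T).linear (a - z)) ^ 2 := by
        refine Finset.sum_comm' fun z T => ?_
        rw [mem_cellsAt, Finset.mem_filter]
        constructor
        · rintro ⟨h1, h2, h3⟩
          exact ⟨⟨h1, h3⟩, hZS z h1 T h2 h3⟩
        · rintro ⟨⟨h1, h2⟩, h3⟩
          exact ⟨h1, hS h3, h2⟩
    _ ≤ ∑ T ∈ S, ∑ z ∈ T, ∑ a ∈ T, ((piece v T).linear (a - z)) ^ 2 := by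
        refine Finset.sum_le_sum fun T _ => Finset.sum_le_sum_of_subset_of_nonneg ?_ ?_
        · intro z hz
          exact (Finset.mem_filter.1 hz).2
        · exact fun z _ _ => Finset.sum_nonneg fun a _ => sq_nonneg _
    _ ≤ _ := Finset.sum_le_sum fun T hT => sum_sq_linear_le hω₀ v (hS hT)

lemma subset_nodes (hT : T ∈ 𝒯.cells) : T ⊆ 𝒯.nodes := by
  classical
  exact fun z hz => Finset.mem_biUnion.2 ⟨T, hT, hz⟩

lemma sum_nodalError (v : Plane → ℝ) :
    ∑ T ∈ 𝒯.cells, 𝒯.nodalError v T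
      = ∑ z ∈ 𝒯.nodes, ∑ T ∈ 𝒯.cellsAt z, (piece v T z - 𝒯.nodalAverage v z) ^ 2 := by
  refine Finset.sum_comm' fun T z => ?_
  rw [mem_cellsAt]
  exact ⟨fun h => ⟨h, subset_nodes h.1 h.2⟩, fun h => h.1⟩

lemma nodalError_le (v : Plane → ℝ) (hT : T ∈ 𝒯.cells) :
    𝒯.nodalError v T
      ≤ ∑ z ∈ T, ∑ T' ∈ 𝒯.cellsAt z, (piece v T' z - 𝒯.nodalAverage v z) ^ 2 := by
  refine Finset.sum_le_sum fun z hz => ?_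
  exact Finset.single_le_sum (f := fun T' => (piece v T' z - 𝒯.nodalAverage v z) ^ 2)
    (fun _ _ => sq_nonneg _) (mem_cellsAt.2 ⟨hT, hz⟩)

lemma sqrt_three_mul_le {κ c E A : ℝ} (hκ : 0 < κ) (h : 4 * κ * E ≤ 24 * c * A) :
    Real.sqrt 3 / 12 * E ≤ Real.sqrt 3 / 2 * c / κ * A := by
  have h1 : E ≤ 6 * c / κ * A := by
    rw [div_mul_eq_mul_div, le_div_iff₀ hκ]
    linarith
  calc Real.sqrt 3 / 12 * E ≤ Real.sqrt 3 / 12 * (6 * c / κ * A) :=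
        mul_le_mul_of_nonneg_left h1 (by positivity)
    _ = _ := by ring

lemma lintegral_domain_le {v : Plane → ℝ} (hv : 𝒯.MemP1 v) :
    ∫⁻ x in Ω, ‖(𝒯.meshSize x)⁻¹ * (v x - 𝒯.J1 v x)‖ₑ ^ 2
      ≤ ENNReal.ofReal (Real.sqrt 3 / 12 * ∑ T ∈ 𝒯.cells, 𝒯.nodalError v T) := by
  have hsub : Ω ≤ᵐ[volume] ⋃ T ∈ 𝒯.cells, interior (hull T) := by
    filter_upwards [𝒯.ae_mem_interior_hull] with x hx hxΩ
    obtain ⟨T, hT, hxT⟩ := hx hxΩ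
    exact Set.mem_biUnion hT hxT
  refine (lintegral_mono_set' hsub).trans ?_
  rw [lintegral_biUnion_interior subset_rfl, Finset.mul_sum,
    ENNReal.ofReal_sum_of_nonneg fun T _ => mul_nonneg (by positivity) (nodalError_nonneg v T)]
  refine Finset.sum_le_sum fun T hT => ?_
  rw [setLIntegral_congr_fun (g := fun x => ‖(diamCell T)⁻¹ * (v x - 𝒯.J1 v x)‖ₑ ^ 2)
    isOpen_interior.measurableSet (fun x hx => by dsimp only; rw [meshSize_eq hT hx])]
  exact (lintegral_mono_set interior_subset).trans (lintegral_cell_le hv hT)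

lemma eLpNorm_domain_le (hΩ : interior (closure Ω) = Ω) {ω₀ : ℝ} (hω₀ : 𝒯.IsMinAngleBound ω₀)
    {v : Plane → ℝ} (hv : 𝒯.MemCR10 v) :
    eLpNorm (fun x => (𝒯.meshSize x)⁻¹ * (v x - 𝒯.J1 v x)) 2 (volume.restrict Ω)
      ≤ ENNReal.ofReal (𝒯.capxJ1 ω₀) * 𝒯.energyNorm v Ω := by
  -- Without triangles `Ω` is empty; this case is separate because `eigenvalueFactor` is then zero.
  rcases 𝒯.cells.eq_empty_or_nonempty with hemp | hne
  · have hcl := 𝒯.closure_eq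
    rw [hemp] at hcl
    have hΩe : Ω = ∅ := by simpa using hcl
    subst hΩe
    simp
  · have hκ := eigenvalueFactor_pos hΩ hne
    obtain ⟨T₀, hT₀⟩ := hne
    have hc := cot_pos hω₀ hT₀
    have hX : 0 ≤ Real.sqrt 3 / 2 * Real.cot ω₀ / 𝒯.eigenvalueFactor := by positivity
    refine eLpNorm_two_le ((lintegral_domain_le hv.1).trans ?_) hX
    have h1 := sum_nodes_le hΩ hω₀ hv (subset_refl 𝒯.nodes) (subset_refl 𝒯.cells)
      (fun z _ T hT _ => hT)
    rw [← sum_nodalError] at h1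
    refine (ENNReal.ofReal_le_ofReal (sqrt_three_mul_le hκ h1)).trans ?_
    rw [ENNReal.ofReal_mul hX]
    gcongr
    exact ofReal_sum_cellEnergy_le v subset_rfl fun T hT => interior_hull_subset hΩ hT

lemma eLpNorm_cell_le (hΩ : interior (closure Ω) = Ω) {ω₀ : ℝ} (hω₀ : 𝒯.IsMinAngleBound ω₀)
    {v : Plane → ℝ} (hv : 𝒯.MemCR10 v) (hT : T ∈ 𝒯.cells) :
    eLpNorm (fun x => (diamCell T)⁻¹ * (v x - 𝒯.J1 v x)) 2 (volume.restrict (hull T))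
      ≤ ENNReal.ofReal (𝒯.capxJ1 ω₀) * 𝒯.energyNorm v (𝒯.cellPatch T) := by
  classical
  have hκ := eigenvalueFactor_pos hΩ ⟨T, hT⟩
  have hc := cot_pos hω₀ hT
  have hX : 0 ≤ Real.sqrt 3 / 2 * Real.cot ω₀ / 𝒯.eigenvalueFactor := by positivity
  refine eLpNorm_two_le ((lintegral_cell_le hv.1 hT).trans ?_) hX
  -- Only the nodes of `T` are used, so only the triangles that share a vertex with `T` contribute,
  -- and these make up the patch.
  have h1 := sum_nodes_le hΩ hω₀ hv (subset_nodes hT)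
    (S := 𝒯.cells.filter fun T' => ∃ z ∈ T, z ∈ T') (Finset.filter_subset _ _)
    (fun z hz T' hT' hz' => Finset.mem_filter.2 ⟨hT', z, hz, hz'⟩)
  have h2 := (mul_le_mul_of_nonneg_left (nodalError_le v hT)
    (by positivity : 0 ≤ 4 * 𝒯.eigenvalueFactor)).trans h1
  refine (ENNReal.ofReal_le_ofReal (sqrt_three_mul_le hκ h2)).trans ?_
  rw [ENNReal.ofReal_mul hX]
  gcongr
  refine ofReal_sum_cellEnergy_le v (Finset.filter_subset _ _) fun T' hT' => ?_
  obtain ⟨h3, z, hz, hz'⟩ := Finset.mem_filter.1 hT'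
  refine interior_subset.trans fun x hx => ?_
  exact Set.mem_biUnion hz (Set.mem_biUnion (mem_cellsAt.2 ⟨h3, hz'⟩) hx)

end RegularTriangulation

end CrouzeixRaviart

/-- The hypothesis on `Ω` holds for every bounded Lipschitz domain; boundedness follows from the
existence of the triangulation. -/
theorem lemma4p5 (Ω : Set CrouzeixRaviart.Plane) (hΩ : interior (closure Ω) = Ω)
    (𝒯 : CrouzeixRaviart.RegularTriangulation Ω) (ω₀ : ℝ) (hω₀ : 𝒯.IsMinAngleBound ω₀)
    (v : CrouzeixRaviart.Plane → ℝ) (hv : 𝒯.MemCR10 v) :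
    𝒯.MemS10 (𝒯.J1 v) ∧
    eLpNorm (fun x => (𝒯.meshSize x)⁻¹ * (v x - 𝒯.J1 v x)) 2 (volume.restrict Ω)
      ≤ ENNReal.ofReal (𝒯.capxJ1 ω₀) * 𝒯.energyNorm v Ω ∧
    ∀ T ∈ 𝒯.cells,
      eLpNorm (fun x => (CrouzeixRaviart.RegularTriangulation.diamCell T)⁻¹ * (v x - 𝒯.J1 v x)) 2
          (volume.restrict (CrouzeixRaviart.hull T))
        ≤ ENNReal.ofReal (𝒯.capxJ1 ω₀) * 𝒯.energyNorm v (𝒯.cellPatch T) :=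
  ⟨CrouzeixRaviart.RegularTriangulation.memS10_J1 hΩ v,
    CrouzeixRaviart.RegularTriangulation.eLpNorm_domain_le hΩ hω₀ hv,
    fun _ hT => CrouzeixRaviart.RegularTriangulation.eLpNorm_cell_le hΩ hω₀ hv hT⟩
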